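/- Let $d\ge 1$ and $n\ge 2$ be integers. Let $\boldsymbol X_i=(X_i^1,\dots,X_i^d)$, $i=1,\dots,n$, be iid random vectors in $\mathbb R^d$, and let $\boldsymbol\alpha=(\alpha_1,\dots,\alpha_d)$ with $\alpha_j>0$. **Privacy channel.** Let $L_n=\lfloor\log_2 n\rfloor$, $\mathcal T_n=\{n/2^r : r=1,\dots,L_n\}$ and $\beta_n^j=\alpha_j/L_n$. Write $[x]_T=\max(\min(x,T),-T)$. The public view of $X_i^j$ is the vector $Z_i^j=(Z_i^{j,T})_{T\in\mathcal T_n}$ with $Z_i^{j,T}=[X_i^j]_T+\mathcal E_i^{j,T}$, where the $\mathcal E_i^{j,T}$ are mutually independent, independent of the data, and $\mathcal E_i^{j,T}$ has the centred Laplace law with scale $2T/\beta_n^j$. **Estimator.** For $\boldsymbol T=(T^{(1)},\dots,T^{(d)}),\ \boldsymbol T'\in\mathcal T_n^d$ set $$\hat\gamma^{(\boldsymbol T)}=\frac1n\sum_{i=1}^n\prod_{j=1}^d Z_i^{j,T^{(j)}},\qquad \hat\gamma^{(\boldsymbol T,\boldsymbol T')}=\frac1n\sum_{i=1}^n\prod_{j=1}^d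 Z_i^{j,T^{(j)}\wedge T'^{(j)}},\qquad \mathbb V_{\boldsymbol T}=\kappa_n\frac{\prod_{j=1}^d |T^{(j)}|^2}{n\prod_{j=1}^d|\beta_n^j|^2},$$ with $\kappa_n=c_0\log n$, $c_0>0$, and $$\mathbb B_{\boldsymbol T}=\sup_{\boldsymbol T'\in\mathcal T_n^d}\Big(\big|\hat\gamma^{(\boldsymbol T,\boldsymbol T')}-\hat\gamma^{(\boldsymbol T')}\big|^2-\mathbb V_{\boldsymbol T'}\Big)_+ .$$ Let $\widehat{\boldsymbol T}$ be any measurable function of the public data with values in $\operatorname{argmin}_{\boldsymbol T\in\mathcal T_n^d}\{\mathbb B_{\boldsymbol T}+\mathbb V_{\boldsymbol T}\}$. **Theorem.** (1) The mechanism is $\boldsymbol\alpha$-componentwise locally differentially private: for every $j$, the Markov kernel $Q^j(\cdot\mid x)$ giving the law of $Z_i^j$ when $X_i^j=x$ satisfies $Q^j(A\mid x)\le e^{\alpha_j}Q^j(A\mid x')$ for all $x,x'\in\mathbb R$ and all Borel sets $A\subseteq\mathbb R^{\mathcal T_n}$. (2) For every $\bar c_0>0$ there is $C_0>0$, depending only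 on $d$ and $\bar c_0$, such that the following holds for every $c_0\ge C_0$. Let $k_1,\dots,k_d>1$ satisfy $\sum_{j=1}^d 1/k_j<1$, let $\bar k=d\big(\sum_{j=1}^d 1/k_j\big)^{-1}$ be their harmonic mean, and let $M\ge0$. There is $c>0$, depending only on $d,\bar c_0,c_0,k_1,\dots,k_d,M$, such that if $X_1^j\in\mathbf L^{k_j}$ with $\|X_1^j\|_{k_j}\le M$ for all $j$, then, with $\gamma=\mathbb E\big[\prod_{j=1}^d X_1^j\big]$, the error $\hat\gamma^{(\widehat{\boldsymbol T})}-\gamma$ is square integrable and $$\mathbb E\Big[\big(\hat\gamma^{(\widehat{\boldsymbol T})}-\gamma\big)^2\Big]\le c\left(\frac{n\prod_{j=1}^d\alpha_j^2}{(\log n)^{2d+1}}\right)^{-\frac{\bar k-d}{\bar k}}+\frac{c}{n^{\bar c_0}\prod_{j=1}^d\alpha_j^2}$$ for all $n\ge2$ and all $\alpha_1,\dots,\alpha_d\in(0,1]$ with $n\prod_{j=1}^d\alpha_j^2\ge(\log n)^{2d+1}$. The estimator does not use the $k_j$ or $M$. -/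

import Mathlib

open MeasureTheory ProbabilityTheory
open scoped NNReal ENNReal

noncomputable section

namespace AdaptiveMoment

/-- Componentwise local differential privacy of a non-interactive mechanism: component `j` is
released through its own Markov kernel `Q j`, and `Q j (A | x) ≤ exp (α j) * Q j (A | x')`
for all raw values `x`, `x'` and all measurable `A`. -/
def IsCLDP {d : ℕ} {𝓧 𝓩 : Fin d → Type*} [∀ j, MeasurableSpace (𝓧 j)]
    [∀ j, MeasurableSpace (𝓩 j)] (α : Fin d → ℝ) (Q : ∀ j, Kernel (𝓧 j) (𝓩 j)) : Prop :=
  ∀ j, IsMarkovKernel (Q j) ∧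
    ∀ (x x' : 𝓧 j) (A : Set (𝓩 j)), MeasurableSet A →
      Q j x A ≤ ENNReal.ofReal (Real.exp (α j)) * Q j x' A

/-- The Laplace law with scale `b > 0`, with density `exp (-|x| / b) / (2 b)`. -/
def laplaceLaw (b : ℝ) : Measure ℝ :=
  volume.withDensity fun x => ENNReal.ofReal (1 / (2 * b) * Real.exp (-|x| / b))

/-- Truncation of `x` to `[-T, T]`. -/
def trunc (x T : ℝ) : ℝ := max (min x T) (-T)

/-- The dyadic truncation levels `n / 2 ^ r`, `r = 1, …, ⌊log₂ n⌋`.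
Here `Nat.log 2 n` is `⌊log₂ n⌋`. -/
def grid (n : ℕ) : Finset ℝ :=
  (Finset.Icc 1 (Nat.log 2 n)).image fun r => (n : ℝ) / 2 ^ r

/-- The noise parameter `β = α / ⌊log₂ n⌋`. -/
def noiseLevel (n : ℕ) (α : ℝ) : ℝ := α / (Nat.log 2 n : ℝ)

/-- The scale of the Laplace noise added at truncation level `T`. -/
def noiseScale (β T : ℝ) : ℝ := 2 * T / β

/-- The public view of one raw value `x`, given the noise `e`: one noisy truncated value for
each truncation level. -/
def publicView {n : ℕ} (x : ℝ) (e : grid n → ℝ) : grid n → ℝ := fun T => trunc x T + e T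

instance (b : ℝ) : SigmaFinite (laplaceLaw b) := by
  unfold laplaceLaw
  exact SigmaFinite.withDensity_ofReal _

theorem measurable_publicView (n : ℕ) :
    Measurable fun p : ℝ × (grid n → ℝ) => publicView p.1 p.2 := by
  unfold publicView trunc
  fun_prop

/-- The channel releasing `publicView x e`, where the coordinates of `e` are independent and the
one at level `T` has the Laplace law with scale `2 T / β`. -/
def channel (n : ℕ) (β : ℝ) : Kernel ℝ (grid n → ℝ) where
  toFun x := (Measure.pi fun T : grid n => laplaceLaw (noiseScale β T)).map (publicView x)
  measurable' := by
    have h : (fun x : ℝ => (Measure.pi fun T : grid n => laplaceLaw (noiseScale β T)).map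
        (publicView x)) = fun x : ℝ =>
        ((Measure.pi fun T : grid n => laplaceLaw (noiseScale β T)).map (Prod.mk x)).map
          (fun p : ℝ × (grid n → ℝ) => publicView p.1 p.2) := by
      funext x
      rw [Measure.map_map (measurable_publicView n) (by fun_prop)]
      rfl
    rw [h]
    exact (Measure.measurable_map _ (measurable_publicView n)).comp Measurable.map_prodMk_left

/-- A sample of size `n`: the raw vectors `X i` are iid with law `ν`; the noise variables
`ξ i j T` are mutually independent, Laplace with scale `2 T / β j`, and independent of the raw
data. -/
structure IsSample {Ω : Type*} [MeasurableSpace Ω] (P : Measure Ω) {d n : ℕ}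
    (ν : Measure (Fin d → ℝ)) (β : Fin d → ℝ) (X : Fin n → Ω → Fin d → ℝ)
    (ξ : Fin n → Fin d → grid n → Ω → ℝ) : Prop where
  law_raw : ∀ i, HasLaw (X i) ν P
  indep_raw : iIndepFun X P
  law_noise : ∀ i j T, HasLaw (ξ i j T) (laplaceLaw (noiseScale (β j) T)) P
  indep_noise : iIndepFun (fun q : Fin n × Fin d × grid n => ξ q.1 q.2.1 q.2.2) P
  indep_raw_noise : IndepFun (fun ω i => X i ω) (fun ω i j T => ξ i j T ω) P

/-- The whole public data set. -/
def publicData {Ω : Type*} {d n : ℕ} (X : Fin n → Ω → Fin d → ℝ)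
    (ξ : Fin n → Fin d → grid n → Ω → ℝ) (ω : Ω) : Fin n → Fin d → grid n → ℝ :=
  fun i j => publicView (X i ω j) fun T => ξ i j T ω

section Estimator

variable {d n : ℕ}

/-- The estimator with fixed truncation levels `T`, as a function of the public data `z`. -/
def momentEst (z : Fin n → Fin d → grid n → ℝ) (T : Fin d → grid n) : ℝ :=
  1 / (n : ℝ) * ∑ i, ∏ j, z i j (T j)

/-- The auxiliary estimator with truncation levels `min (T j) (T' j)`. -/
def momentEstPair (z : Fin n → Fin d → grid n → ℝ) (T T' : Fin d → grid n) : ℝ :=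
  1 / (n : ℝ) * ∑ i, ∏ j, z i j (min (T j) (T' j))

/-- The variance penalty. -/
def penalty (κ : ℝ) (β : Fin d → ℝ) (T : Fin d → grid n) : ℝ :=
  κ * ((∏ j, (T j : ℝ) ^ 2) / ((n : ℝ) * ∏ j, β j ^ 2))

/-- The penalised bias proxy, a supremum over the finite set of all truncation vectors. -/
def biasProxy (κ : ℝ) (β : Fin d → ℝ) (z : Fin n → Fin d → grid n → ℝ)
    (T : Fin d → grid n) : ℝ :=
  ⨆ T' : Fin d → grid n,
    max (|momentEstPair z T T' - momentEst z T'| ^ 2 - penalty κ β T') 0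

/-- `S` is a data-driven (measurable) choice of truncation levels that minimises
bias proxy plus penalty; ties may be broken in any way. -/
def IsSelector (κ : ℝ) (β : Fin d → ℝ)
    (S : (Fin n → Fin d → grid n → ℝ) → Fin d → grid n) : Prop :=
  Measurable S ∧ ∀ z T,
    biasProxy κ β z (S z) + penalty κ β (S z) ≤ biasProxy κ β z T + penalty κ β T

end Estimator

/-- The harmonic mean of `k 1, …, k d`. -/
def harmonicMean {d : ℕ} (k : Fin d → ℝ) : ℝ := d * (∑ j, 1 / k j)⁻¹

end AdaptiveMoment

end

/-!
Privacy. Two truncated values at level `T` differ by at most `2 T`, so Laplace noise of scale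
`2 T / β` makes their laws comparable up to the factor `exp β` (`map_add_laplaceLaw_le`). The
levels are released independently and there are at most `⌊log₂ n⌋` of them, hence the product of
the factors is at most `exp α` (`pi_le_prod_smul_pi`, `isCLDP_channel`).

Risk. The estimator with levels `T` has mean `truncMoment ν T`, the expectation of the product of
the truncated coordinates. The proof rests on three facts.

* Concentration (`exists_measureReal_deviation_le`). A product of `d` Laplace variables has no
  exponential moment for `d > 1`. Instead, each noise variable is set to zero when it exceeds a
  multiple of `log n` times its scale. By symmetry this introduces no bias, it changes nothing
  outside an event of polynomially small probability, and it makes the summands bounded, so that a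
  Bernstein-type inequality applies. For a large constant in the penalty, the squared deviations
  are below a sixth of the penalty simultaneously for all levels, with probability polynomially
  close to one.
* Bias (`abs_truncMoment_sub_le`, `abs_truncMoment_min_sub_le`). Truncation matters only where some
  `|x j|` exceeds `T j`, and there `∏ |x i|` is at most `T j ^ (-ρ) * |x j| ^ ρ * ∏ |x i|` with
  `ρ = k j * (1 - ∑ 1 / k)`. The exponent `ρ` is the one for which Hölder's inequality with the
  exponents `k i` is exactly exhausted (`integrable_momentMajorant`).
* Oracle inequality (`IsSelector.sq_error_le`). On the concentration event, the bias proxy at any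
  levels `T` is at most a constant times the squared bias, and the usual Goldenshluger–Lepski
  comparison through the levels `min T (S z)` bounds the error by squared bias plus penalty at `T`.

Levels `T j` of order `N ^ (1 / (2 k j))`, with `N = n ∏ α ^ 2 / (log n) ^ (2 d + 1)`, balance the
two terms at the rate `N ^ (-(1 - ∑ 1 / k))` (`exists_oracle`). On the exceptional event a crude
fourth-moment bound, polynomial in `n` and of order `∏ α ^ (-4)`, is weighed against the
probability of the event (`integral_sq_le_of_good_event`), which gives the second term of the
bound.
-/

namespace AdaptiveMoment

/-! ### The Laplace law -/

theorem lintegral_exp_neg_mul_abs {c : ℝ} (hc : 0 < c) :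
    ∫⁻ x : ℝ, ENNReal.ofReal (Real.exp (-c * |x|)) = ENNReal.ofReal (2 / c) := by
  have h : ∫ x : ℝ, Real.exp (-c * |x|) = 2 / c := by
    rw [integral_comp_abs (f := fun x => Real.exp (-c * x)),
      integral_exp_mul_Ioi (neg_neg_of_pos hc)]
    simp [div_eq_mul_inv]
  have hint : Integrable (fun x : ℝ => Real.exp (-c * |x|)) := by
    by_contra hn
    rw [integral_undef hn] at h
    exact (div_pos two_pos hc).ne h
  rw [← ofReal_integral_eq_lintegral_ofReal hint (ae_of_all _ fun x => (Real.exp_pos _).le), h]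

theorem measurable_laplaceDensity (b u : ℝ) :
    Measurable fun x : ℝ => ENNReal.ofReal (1 / (2 * b) * Real.exp (-|x - u| / b)) := by
  fun_prop

/-- The Laplace law has exponential moments of every order below `1 / b`; order `1 / (2 b)` is
enough for the tail and moment bounds. -/
theorem lintegral_exp_laplaceLaw {b : ℝ} (hb : 0 < b) :
    ∫⁻ x, ENNReal.ofReal (Real.exp (|x| / (2 * b))) ∂laplaceLaw b = 2 := by
  have hm := measurable_laplaceDensity b 0
  simp only [sub_zero] at hm
  rw [laplaceLaw, lintegral_withDensity_eq_lintegral_mul _ hm (by fun_prop)]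
  have h : ∀ x : ℝ, ((fun x : ℝ => ENNReal.ofReal (1 / (2 * b) * Real.exp (-|x| / b))) *
      fun x => ENNReal.ofReal (Real.exp (|x| / (2 * b)))) x =
      ENNReal.ofReal (1 / (2 * b)) * ENNReal.ofReal (Real.exp (-(1 / (2 * b)) * |x|)) := by
    intro x
    simp only [Pi.mul_apply]
    rw [← ENNReal.ofReal_mul (by positivity), ← ENNReal.ofReal_mul (by positivity), mul_assoc,
      ← Real.exp_add]
    congr 3
    field_simp
    ring
  rw [lintegral_congr h, lintegral_const_mul _ (by fun_prop),
    lintegral_exp_neg_mul_abs (by positivity), ← ENNReal.ofReal_mul (by positivity)]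
  rw [show 1 / (2 * b) * (2 / (1 / (2 * b))) = 2 by field_simp]
  simp

theorem isProbabilityMeasure_laplaceLaw {b : ℝ} (hb : 0 < b) :
    IsProbabilityMeasure (laplaceLaw b) := by
  refine ⟨?_⟩
  rw [laplaceLaw, withDensity_apply _ MeasurableSet.univ, Measure.restrict_univ]
  have h : ∀ x : ℝ, ENNReal.ofReal (1 / (2 * b) * Real.exp (-|x| / b)) =
      ENNReal.ofReal (1 / (2 * b)) * ENNReal.ofReal (Real.exp (-(1 / b) * |x|)) := by
    intro x
    rw [← ENNReal.ofReal_mul (by positivity)]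
    congr 3
    ring
  rw [lintegral_congr h, lintegral_const_mul _ (by fun_prop),
    lintegral_exp_neg_mul_abs (by positivity), ← ENNReal.ofReal_mul (by positivity)]
  rw [show 1 / (2 * b) * (2 / (1 / b)) = 1 by field_simp]
  simp

/-- Translating the Laplace law translates its density. -/
theorem map_add_laplaceLaw (b u : ℝ) :
    (laplaceLaw b).map (fun x => u + x) =
      volume.withDensity fun y => ENNReal.ofReal (1 / (2 * b) * Real.exp (-|y - u| / b)) := by
  ext A hA
  have hA' : MeasurableSet ((fun x : ℝ => u + x) ⁻¹' A) := (measurable_const_add u) hA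
  rw [Measure.map_apply (measurable_const_add u) hA, laplaceLaw, withDensity_apply _ hA',
    withDensity_apply _ hA, ← lintegral_indicator hA', ← lintegral_indicator hA]
  conv_rhs => rw [← lintegral_add_left_eq_self _ u]
  refine lintegral_congr fun x => ?_
  simp only [Set.indicator, add_sub_cancel_left]
  rfl

/-! ### Privacy of the channel -/

/-- Two centres at distance at most `D` give Laplace laws whose densities differ by a factor of
at most `exp (D / b)`. -/
theorem map_add_laplaceLaw_le {b D u u' : ℝ} (hb : 0 < b) (h : |u - u'| ≤ D) :
    (laplaceLaw b).map (fun x => u + x) ≤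
      Real.toNNReal (Real.exp (D / b)) • (laplaceLaw b).map (fun x => u' + x) := by
  rw [map_add_laplaceLaw, map_add_laplaceLaw]
  have hs : Real.toNNReal (Real.exp (D / b)) • (volume.withDensity fun y : ℝ =>
      ENNReal.ofReal (1 / (2 * b) * Real.exp (-|y - u'| / b))) =
      volume.withDensity (ENNReal.ofReal (Real.exp (D / b)) • fun y : ℝ =>
        ENNReal.ofReal (1 / (2 * b) * Real.exp (-|y - u'| / b))) := by
    rw [withDensity_smul _ (measurable_laplaceDensity b u')]
    rfl
  rw [hs]
  refine withDensity_mono (ae_of_all _ fun y => ?_)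
  simp only [Pi.smul_apply, smul_eq_mul]
  rw [← ENNReal.ofReal_mul (by positivity)]
  refine ENNReal.ofReal_le_ofReal ?_
  rw [mul_left_comm, ← Real.exp_add]
  gcongr
  rw [← add_div]
  gcongr
  have := abs_sub_le y u u'
  linarith

/-- A pointwise comparison of the factors gives a comparison of finite product measures. -/
theorem pi_le_prod_smul_pi {ι : Type*} [Fintype ι] {E : ι → Type*} [∀ i, MeasurableSpace (E i)]
    {μ ν : ∀ i, Measure (E i)} [∀ i, IsFiniteMeasure (μ i)] [∀ i, IsFiniteMeasure (ν i)]
    {c : ι → ℝ≥0} (h : ∀ i, μ i ≤ c i • ν i) :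
    Measure.pi μ ≤ (∏ i, c i) • Measure.pi ν := by
  have hpi : Measure.pi (fun i => c i • ν i) = (∏ i, c i) • Measure.pi ν := by
    refine Measure.pi_eq fun s _ => ?_
    simp only [Measure.smul_apply, Measure.pi_pi, ENNReal.smul_def, smul_eq_mul,
      Finset.prod_mul_distrib]
    push_cast
    rfl
  rw [← hpi]
  refine Measure.le_intro fun A hA _ => ?_
  have hle : (Measure.pi μ).toOuterMeasure ≤
      OuterMeasure.pi fun i => (c i • ν i).toOuterMeasure := by
    refine OuterMeasure.le_pi.2 fun s _ => ?_
    change Measure.pi μ (Set.univ.pi s) ≤ ∏ i, (c i • ν i) (s i)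
    rw [Measure.pi_pi]
    exact Finset.prod_le_prod' fun i _ => h i (s i)
  calc Measure.pi μ A ≤ OuterMeasure.pi (fun i => (c i • ν i).toOuterMeasure) A := hle A
    _ = Measure.pi (fun i => c i • ν i) A := by
      rw [Measure.pi, toMeasure_apply _ _ hA]

theorem abs_trunc_le {x T : ℝ} (hT : 0 ≤ T) : |trunc x T| ≤ T := by
  unfold trunc
  exact abs_le.2 ⟨le_max_right _ _, max_le (min_le_right _ _) (by linarith)⟩

theorem mem_grid {n : ℕ} {T : ℝ} :
    T ∈ grid n ↔ ∃ r, (1 ≤ r ∧ r ≤ Nat.log 2 n) ∧ (n : ℝ) / 2 ^ r = T := by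
  simp [grid]

theorem one_le_of_mem_grid {n : ℕ} (hn : 2 ≤ n) {T : ℝ} (hT : T ∈ grid n) : 1 ≤ T := by
  obtain ⟨r, ⟨-, hr⟩, rfl⟩ := mem_grid.1 hT
  rw [one_le_div (by positivity)]
  exact_mod_cast (Nat.pow_le_pow_right two_pos hr).trans (Nat.pow_log_le_self 2 (by omega))

theorem le_of_mem_grid {n : ℕ} {T : ℝ} (hT : T ∈ grid n) : T ≤ n := by
  obtain ⟨r, -, rfl⟩ := mem_grid.1 hT
  exact div_le_self (by positivity) (one_le_pow₀ one_le_two)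

theorem card_grid_le (n : ℕ) : (grid n).card ≤ Nat.log 2 n := by
  simpa [grid] using Finset.card_image_le (s := Finset.Icc 1 (Nat.log 2 n))
    (f := fun r => (n : ℝ) / 2 ^ r)

theorem one_le_log_two {n : ℕ} (hn : 2 ≤ n) : (1 : ℝ) ≤ (Nat.log 2 n : ℝ) := by
  exact_mod_cast Nat.log_pos one_lt_two hn

theorem noiseScale_pos {n : ℕ} (hn : 2 ≤ n) {β T : ℝ} (hβ : 0 < β) (hT : T ∈ grid n) :
    0 < noiseScale β T := by
  have := one_le_of_mem_grid hn hT
  unfold noiseScale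
  positivity

theorem channel_apply {n : ℕ} (hn : 2 ≤ n) {β : ℝ} (hβ : 0 < β) (x : ℝ) :
    channel n β x = Measure.pi fun T : grid n =>
      (laplaceLaw (noiseScale β T)).map fun e => trunc x T + e := by
  have := fun T : grid n => isProbabilityMeasure_laplaceLaw (noiseScale_pos hn hβ T.2)
  have := fun T : grid n => Measure.isProbabilityMeasure_map (μ := laplaceLaw (noiseScale β T))
    (measurable_const_add (trunc x T)).aemeasurable
  exact Measure.pi_map_pi (f := fun (T : grid n) (e : ℝ) => trunc x T + e)
    fun T => (measurable_const_add (trunc x T)).aemeasurable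

/-- Each released level costs `β = α / ⌊log₂ n⌋`, because truncated values differ by at most
`2 T` while the noise has scale `2 T / β`; there are at most `⌊log₂ n⌋` levels. -/
theorem isCLDP_channel {d n : ℕ} (hn : 2 ≤ n) {α : Fin d → ℝ} (hα : ∀ j, 0 < α j) :
    IsCLDP α fun j => channel n (noiseLevel n (α j)) := by
  intro j
  have hL := one_le_log_two hn
  have hβ : 0 < noiseLevel n (α j) := div_pos (hα j) (by linarith)
  have hprob := fun T : grid n => isProbabilityMeasure_laplaceLaw (noiseScale_pos hn hβ T.2)
  have hmap : ∀ (x : ℝ) (T : grid n), IsProbabilityMeasure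
      ((laplaceLaw (noiseScale (noiseLevel n (α j)) T)).map fun e => trunc x T + e) :=
    fun x T => Measure.isProbabilityMeasure_map (measurable_const_add (trunc x T)).aemeasurable
  refine ⟨⟨fun x => ?_⟩, fun x x' A _ => ?_⟩
  · rw [channel_apply hn hβ]
    infer_instance
  rw [channel_apply hn hβ, channel_apply hn hβ]
  have hfac : ∀ T : grid n,
      (laplaceLaw (noiseScale (noiseLevel n (α j)) T)).map (fun e => trunc x T + e) ≤
        Real.toNNReal (Real.exp (noiseLevel n (α j))) •
          (laplaceLaw (noiseScale (noiseLevel n (α j)) T)).map (fun e => trunc x' T + e) := by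
    intro T
    have hT := one_le_of_mem_grid hn T.2
    have hD : |trunc x T - trunc x' T| ≤ 2 * (T : ℝ) := by
      have h1 := abs_trunc_le (x := x) (T := (T : ℝ)) (by linarith)
      have h2 := abs_trunc_le (x := x') (T := (T : ℝ)) (by linarith)
      have := abs_sub (trunc x T) (trunc x' T)
      linarith
    have := map_add_laplaceLaw_le (noiseScale_pos hn hβ T.2) hD
    rwa [show 2 * (T : ℝ) / noiseScale (noiseLevel n (α j)) T = noiseLevel n (α j) by
      unfold noiseScale; field_simp] at this
  refine (pi_le_prod_smul_pi hfac A).trans ?_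
  rw [Measure.smul_apply, ENNReal.smul_def, smul_eq_mul]
  gcongr
  change ((∏ _T : grid n, Real.toNNReal (Real.exp (noiseLevel n (α j))) : ℝ≥0) : ℝ≥0∞) ≤
    ((Real.toNNReal (Real.exp (α j)) : ℝ≥0) : ℝ≥0∞)
  rw [ENNReal.coe_le_coe, Finset.prod_const, Finset.card_univ, Fintype.card_coe,
    ← Real.toNNReal_pow (Real.exp_pos _).le, ← Real.exp_nat_mul]
  refine Real.toNNReal_le_toNNReal (Real.exp_le_exp.2 ?_)
  calc ((grid n).card : ℝ) * noiseLevel n (α j)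
      ≤ (Nat.log 2 n : ℝ) * noiseLevel n (α j) := by
        gcongr
        exact card_grid_le n
    _ = α j := by unfold noiseLevel; field_simp

/-! ### An exponential inequality for bounded variables -/

theorem mgf_le_exp_of_abs_le {Ω : Type*} [MeasurableSpace Ω] {P : Measure Ω}
    [IsProbabilityMeasure P] {Y : Ω → ℝ} {B v l : ℝ} (hm : AEMeasurable Y P)
    (hB : ∀ ω, |Y ω| ≤ B) (h0 : ∫ ω, Y ω ∂P = 0) (hv : ∫ ω, Y ω ^ 2 ∂P ≤ v) (hl : 0 ≤ l)
    (hlB : l * B ≤ 1) : mgf Y P l ≤ Real.exp (l ^ 2 * v) := by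
  have hY : Integrable Y P := .of_bound hm.aestronglyMeasurable B (ae_of_all _ hB)
  have hY2 : Integrable (fun ω => Y ω ^ 2) P :=
    .of_bound (hm.pow_const 2).aestronglyMeasurable (B ^ 2) (ae_of_all _ fun ω => by
      rw [Real.norm_eq_abs, abs_pow]
      exact pow_le_pow_left₀ (abs_nonneg _) (hB ω) 2)
  have hpt : ∀ ω, Real.exp (l * Y ω) ≤ 1 + l * Y ω + l ^ 2 * Y ω ^ 2 := by
    intro ω
    have h1 : |l * Y ω| ≤ 1 := by
      rw [abs_mul, abs_of_nonneg hl]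
      exact (mul_le_mul_of_nonneg_left (hB ω) hl).trans hlB
    have := (abs_le.1 (Real.abs_exp_sub_one_sub_id_le h1)).2
    rw [mul_pow] at this
    linarith
  have hint : Integrable (fun ω => 1 + l * Y ω + l ^ 2 * Y ω ^ 2) P :=
    ((integrable_const _).add (hY.const_mul l)).add (hY2.const_mul _)
  calc mgf Y P l ≤ ∫ ω, (1 + l * Y ω + l ^ 2 * Y ω ^ 2) ∂P :=
        integral_mono_of_nonneg (ae_of_all _ fun ω => (Real.exp_pos _).le) hint (ae_of_all _ hpt)
    _ = 1 + l ^ 2 * ∫ ω, Y ω ^ 2 ∂P := by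
        have h1 : Integrable (fun ω => 1 + l * Y ω) P := (integrable_const _).add (hY.const_mul l)
        rw [integral_add h1 (hY2.const_mul _),
          integral_add (integrable_const _) (hY.const_mul l), integral_const_mul,
          integral_const_mul, h0]
        simp
    _ ≤ l ^ 2 * v + 1 := by
        have := mul_le_mul_of_nonneg_left hv (sq_nonneg l)
        linarith
    _ ≤ Real.exp (l ^ 2 * v) := Real.add_one_le_exp _

theorem measureReal_le_sum_le {Ω : Type*} [MeasurableSpace Ω] {P : Measure Ω}
    [IsProbabilityMeasure P] {n : ℕ} {Y : Fin n → Ω → ℝ} {B v l : ℝ} (hind : iIndepFun Y P)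
    (hm : ∀ i, AEMeasurable (Y i) P) (hB : ∀ i ω, |Y i ω| ≤ B) (h0 : ∀ i, ∫ ω, Y i ω ∂P = 0)
    (hv : ∀ i, ∫ ω, Y i ω ^ 2 ∂P ≤ v) (hl : 0 ≤ l) (hlB : l * B ≤ 1) (t : ℝ) :
    P.real {ω | t ≤ ∑ i, Y i ω} ≤ Real.exp (-(l * t) + n * (l ^ 2 * v)) := by
  have hint : Integrable (fun ω => Real.exp (l * (∑ i, Y i) ω)) P := by
    refine .of_bound (Real.measurable_exp.comp_aemeasurable
      ((Finset.univ.aemeasurable_sum fun i _ => hm i).const_mul l)).aestronglyMeasurable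
      (Real.exp (l * (n * B))) (ae_of_all _ fun ω => ?_)
    rw [Real.norm_eq_abs, Real.abs_exp, Finset.sum_apply]
    gcongr
    calc ∑ i, Y i ω ≤ ∑ _i : Fin n, B :=
          Finset.sum_le_sum fun i _ => (le_abs_self _).trans (hB i ω)
      _ = n * B := by simp
  have h := measure_ge_le_exp_mul_mgf t hl hint
  rw [hind.mgf_sum₀ hm] at h
  simp only [Finset.sum_apply] at h
  refine h.trans ?_
  rw [Real.exp_add, neg_mul]
  gcongr
  calc ∏ i, mgf (Y i) P l ≤ ∏ _i : Fin n, Real.exp (l ^ 2 * v) :=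
        Finset.prod_le_prod (fun i _ => mgf_nonneg) fun i _ =>
          mgf_le_exp_of_abs_le (hm i) (hB i) (h0 i) (hv i) hl hlB
    _ = Real.exp (n * (l ^ 2 * v)) := by
        rw [Finset.prod_const, Finset.card_univ, Fintype.card_fin, ← Real.exp_nat_mul]

/-- A Bernstein-type bound: within the range `l ≤ 1 / B` the exponential moment of order `l` of
a centred variable bounded by `B` is controlled by its variance. -/
theorem measureReal_le_abs_sum_le {Ω : Type*} [MeasurableSpace Ω] {P : Measure Ω}
    [IsProbabilityMeasure P] {n : ℕ} {Y : Fin n → Ω → ℝ} {B v l : ℝ} (hind : iIndepFun Y P)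
    (hm : ∀ i, AEMeasurable (Y i) P) (hB : ∀ i ω, |Y i ω| ≤ B) (h0 : ∀ i, ∫ ω, Y i ω ∂P = 0)
    (hv : ∀ i, ∫ ω, Y i ω ^ 2 ∂P ≤ v) (hl : 0 ≤ l) (hlB : l * B ≤ 1) (t : ℝ) :
    P.real {ω | t ≤ |∑ i, Y i ω|} ≤ 2 * Real.exp (-(l * t) + n * (l ^ 2 * v)) := by
  have h1 := measureReal_le_sum_le hind hm hB h0 hv hl hlB t
  have h2 := measureReal_le_sum_le (Y := fun i ω => -Y i ω) (B := B) (v := v)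
    (hind.comp (fun _ x => -x) fun _ => measurable_neg) (fun i => (hm i).neg)
    (fun i ω => by rw [abs_neg]; exact hB i ω) (fun i => by rw [integral_neg, h0, neg_zero])
    (fun i => by simpa only [neg_sq] using hv i) hl hlB t
  have hsub : {ω | t ≤ |∑ i, Y i ω|} ⊆ {ω | t ≤ ∑ i, Y i ω} ∪ {ω | t ≤ ∑ i, -Y i ω} := by
    intro ω hω
    simpa [Finset.sum_neg_distrib, le_abs] using hω
  calc P.real {ω | t ≤ |∑ i, Y i ω|}
      ≤ P.real ({ω | t ≤ ∑ i, Y i ω} ∪ {ω | t ≤ ∑ i, -Y i ω}) := measureReal_mono hsub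
    _ ≤ _ := measureReal_union_le _ _
    _ ≤ _ := by linarith

/-! ### Moments of one noisy observation -/

/-- Functions dominated by `K * exp (|e| / (2 b))` are integrable against the Laplace law, with
integral at most `2 K`. -/
theorem integrable_laplaceLaw_of_le {b K : ℝ} (hb : 0 < b) {f : ℝ → ℝ}
    (hf : Measurable f) (h : ∀ e, |f e| ≤ K * Real.exp (|e| / (2 * b))) :
    Integrable f (laplaceLaw b) ∧ ∫ e, f e ∂laplaceLaw b ≤ 2 * K := by
  have hexp : Integrable (fun e => Real.exp (|e| / (2 * b))) (laplaceLaw b) := by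
    refine ⟨by fun_prop, ?_⟩
    rw [hasFiniteIntegral_iff_ofReal (ae_of_all _ fun e => (Real.exp_pos _).le),
      lintegral_exp_laplaceLaw hb]
    exact ENNReal.ofNat_lt_top
  have hval : ∫ e, Real.exp (|e| / (2 * b)) ∂laplaceLaw b = 2 := by
    rw [integral_eq_lintegral_of_nonneg_ae (ae_of_all _ fun e => (Real.exp_pos _).le)
      (by fun_prop), lintegral_exp_laplaceLaw hb]
    simp
  have hfi : Integrable f (laplaceLaw b) :=
    (hexp.const_mul K).mono' hf.aestronglyMeasurable (ae_of_all _ h)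
  refine ⟨hfi, ?_⟩
  calc ∫ e, f e ∂laplaceLaw b ≤ ∫ e, K * Real.exp (|e| / (2 * b)) ∂laplaceLaw b :=
        integral_mono hfi (hexp.const_mul K) fun e => (le_abs_self _).trans (h e)
    _ = 2 * K := by rw [integral_const_mul, hval, mul_comm]

theorem measureReal_laplaceLaw_lt_abs_le {b : ℝ} (hb : 0 < b) (a : ℝ) :
    (laplaceLaw b).real {e | a * b < |e|} ≤ 2 * Real.exp (-(a / 2)) := by
  have hs : MeasurableSet {e : ℝ | a * b < |e|} :=
    measurableSet_lt measurable_const (by fun_prop)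
  have h := (integrable_laplaceLaw_of_le (K := Real.exp (-(a / 2))) hb
    (measurable_const.indicator hs (f := fun _ => (1 : ℝ))) fun e => ?_).2
  · rwa [integral_indicator_const _ hs, smul_eq_mul, mul_one] at h
  rw [← Real.exp_add]
  by_cases he : a * b < |e|
  · rw [Set.indicator_of_mem (show e ∈ {e : ℝ | a * b < |e|} from he), abs_one]
    refine Real.one_le_exp ?_
    have : a / 2 ≤ |e| / (2 * b) := by
      rw [div_le_div_iff₀ two_pos (by positivity)]
      linarith
    linarith
  · rw [Set.indicator_of_notMem (show e ∉ {e : ℝ | a * b < |e|} from he), abs_zero]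
    positivity

/-- The value `e` if `|e| ≤ c`, and `0` otherwise. The function is odd, so that symmetric
noise stays centred. -/
noncomputable def cut (c e : ℝ) : ℝ := if |e| ≤ c then e else 0

theorem measurable_cut (c : ℝ) : Measurable (cut c) :=
  Measurable.ite (measurableSet_le (by fun_prop) measurable_const) measurable_id measurable_const

theorem abs_cut_le {c : ℝ} (hc : 0 ≤ c) (e : ℝ) : |cut c e| ≤ c := by
  unfold cut
  split_ifs with h
  · exact h
  · simpa using hc

theorem abs_cut_le_abs (c e : ℝ) : |cut c e| ≤ |e| := by
  unfold cut
  split_ifs <;> simp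

theorem cut_of_abs_le {c e : ℝ} (h : |e| ≤ c) : cut c e = e := if_pos h

theorem cut_neg (c e : ℝ) : cut c (-e) = -cut c e := by
  unfold cut
  rw [abs_neg]
  split_ifs <;> simp

theorem integral_cut_laplaceLaw (b c : ℝ) : ∫ e, cut c e ∂laplaceLaw b = 0 := by
  have hm := measurable_laplaceDensity b 0
  simp only [sub_zero] at hm
  rw [laplaceLaw, integral_withDensity_eq_integral_toReal_smul hm
    (ae_of_all _ fun _ => ENNReal.ofReal_lt_top)]
  have h := integral_neg_eq_self (fun x : ℝ =>
    (ENNReal.ofReal (1 / (2 * b) * Real.exp (-|x| / b))).toReal • cut c x) volume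
  simp only [abs_neg, cut_neg, smul_neg, integral_neg] at h
  linarith

theorem measurable_trunc (T : ℝ) : Measurable fun x => trunc x T := by
  unfold trunc
  fun_prop

theorem measurable_noisyProd {d : ℕ} (T : Fin d → ℝ) {g : Fin d → ℝ → ℝ}
    (hg : ∀ j, Measurable (g j)) :
    Measurable fun p : (Fin d → ℝ) × (Fin d → ℝ) => ∏ j, (trunc (p.1 j) (T j) + g j (p.2 j)) := by
  refine Finset.measurable_prod _ fun j _ => ?_
  exact ((measurable_trunc (T j)).comp (by fun_prop)).add ((hg j).comp (by fun_prop))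

/-- A function of the raw value and the noise which is dominated by a product of exponentials of
the noise is integrable, with an explicit bound on its integral. -/
theorem integrable_prod_pi_laplaceLaw_of_le {d : ℕ} {ν : Measure (Fin d → ℝ)}
    [IsProbabilityMeasure ν] {b K : Fin d → ℝ} (hb : ∀ j, 0 < b j) (hK : ∀ j, 0 ≤ K j)
    {F : (Fin d → ℝ) × (Fin d → ℝ) → ℝ} (hF : Measurable F)
    (h : ∀ p, |F p| ≤ ∏ j, K j * Real.exp (|p.2 j| / (2 * b j))) :
    Integrable F (ν.prod (Measure.pi fun j => laplaceLaw (b j))) ∧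
      ∫ p, F p ∂(ν.prod (Measure.pi fun j => laplaceLaw (b j))) ≤ ∏ j, 2 * K j := by
  have := fun j => isProbabilityMeasure_laplaceLaw (hb j)
  have h1 : ∀ j, Integrable (fun e => K j * Real.exp (|e| / (2 * b j))) (laplaceLaw (b j)) ∧
      ∫ e, K j * Real.exp (|e| / (2 * b j)) ∂laplaceLaw (b j) ≤ 2 * K j := fun j =>
    integrable_laplaceLaw_of_le (hb j) (by fun_prop) fun e =>
      (abs_of_nonneg (mul_nonneg (hK j) (Real.exp_pos _).le)).le
  have h2 : Integrable (fun e : Fin d → ℝ => ∏ j, K j * Real.exp (|e j| / (2 * b j)))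
      (Measure.pi fun j => laplaceLaw (b j)) := Integrable.fintype_prod fun j => (h1 j).1
  have h3 : Integrable (fun p : (Fin d → ℝ) × (Fin d → ℝ) =>
      ∏ j, K j * Real.exp (|p.2 j| / (2 * b j)))
      (ν.prod (Measure.pi fun j => laplaceLaw (b j))) := h2.comp_snd ν
  have h4 := h3.mono' hF.aestronglyMeasurable (ae_of_all _ h)
  refine ⟨h4, ?_⟩
  calc ∫ p, F p ∂(ν.prod (Measure.pi fun j => laplaceLaw (b j)))
      ≤ ∫ p : (Fin d → ℝ) × (Fin d → ℝ), ∏ j, K j * Real.exp (|p.2 j| / (2 * b j))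
          ∂(ν.prod (Measure.pi fun j => laplaceLaw (b j))) :=
        integral_mono h4 h3 fun p => (le_abs_self _).trans (h p)
    _ = ∏ j, ∫ e, K j * Real.exp (|e| / (2 * b j)) ∂laplaceLaw (b j) := by
        rw [integral_fun_snd fun e : Fin d → ℝ => ∏ j, K j * Real.exp (|e j| / (2 * b j))]
        simp only [probReal_univ, one_smul]
        exact integral_fintype_prod_eq_prod
          (fun j (e : ℝ) => K j * Real.exp (|e| / (2 * b j)))
    _ ≤ ∏ j, 2 * K j := Finset.prod_le_prod
        (fun j _ => integral_nonneg fun e => mul_nonneg (hK j) (Real.exp_pos _).le)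
        fun j _ => (h1 j).2

theorem sq_trunc_add_le {x T b e g : ℝ} (hT : 0 ≤ T) (hTb : T ≤ b) (hb : 0 < b)
    (hg : |g| ≤ |e|) : (trunc x T + g) ^ 2 ≤ 18 * b ^ 2 * Real.exp (|e| / (2 * b)) := by
  have h1 : trunc x T ^ 2 ≤ b ^ 2 := by
    rw [← sq_abs]
    exact pow_le_pow_left₀ (abs_nonneg _) ((abs_trunc_le hT).trans hTb) 2
  have h2 : g ^ 2 ≤ |e| ^ 2 := by rw [← sq_abs g]; gcongr
  have h3 := Real.pow_div_factorial_le_exp (x := |e| / (2 * b)) (by positivity) 2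
  have h4 : |e| ^ 2 = 8 * b ^ 2 * ((|e| / (2 * b)) ^ 2 / (Nat.factorial 2 : ℕ)) := by
    simp [Nat.factorial, -sq_abs]
    field_simp
    ring
  have h5 : 1 ≤ Real.exp (|e| / (2 * b)) := Real.one_le_exp (by positivity)
  have h6 : |e| ^ 2 ≤ 8 * b ^ 2 * Real.exp (|e| / (2 * b)) := by rw [h4]; gcongr
  have h7 : b ^ 2 ≤ b ^ 2 * Real.exp (|e| / (2 * b)) := le_mul_of_one_le_right (by positivity) h5
  nlinarith [sq_nonneg (trunc x T - g)]

theorem pow_four_trunc_add_le {x T b e : ℝ} (hT : 0 ≤ T) (hTb : T ≤ b) (hb : 0 < b) :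
    (trunc x T + e) ^ 4 ≤ 3080 * b ^ 4 * Real.exp (|e| / (2 * b)) := by
  have h1 : trunc x T ^ 4 ≤ b ^ 4 := by
    rw [← Even.pow_abs ⟨2, rfl⟩]
    exact pow_le_pow_left₀ (abs_nonneg _) ((abs_trunc_le hT).trans hTb) 4
  have h3 := Real.pow_div_factorial_le_exp (x := |e| / (2 * b)) (by positivity) 4
  have h4 : e ^ 4 = 384 * b ^ 4 * ((|e| / (2 * b)) ^ 4 / (Nat.factorial 4 : ℕ)) := by
    rw [div_pow, Even.pow_abs ⟨2, rfl⟩]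
    simp [Nat.factorial]
    field_simp
    ring
  have h5 : 1 ≤ Real.exp (|e| / (2 * b)) := Real.one_le_exp (by positivity)
  have h6 : e ^ 4 ≤ 384 * b ^ 4 * Real.exp (|e| / (2 * b)) := by rw [h4]; gcongr
  have h7 : b ^ 4 ≤ b ^ 4 * Real.exp (|e| / (2 * b)) := le_mul_of_one_le_right (by positivity) h5
  have h8 : (trunc x T + e) ^ 4 ≤ 2 ^ (4 - 1) * (trunc x T ^ 4 + e ^ 4) :=
    Even.add_pow_le ⟨2, rfl⟩
  norm_num at h8
  linarith

/-- The mean of the product of the truncated coordinates, which is the mean of the estimator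
with truncation levels `T`. -/
noncomputable def truncMoment {d : ℕ} (ν : Measure (Fin d → ℝ)) (T : Fin d → ℝ) : ℝ :=
  ∫ x, ∏ j, trunc (x j) (T j) ∂ν

/-- The noise scale of the product of `d` noisy values. -/
noncomputable def scaleProd {d : ℕ} (β T : Fin d → ℝ) : ℝ := ∏ j, noiseScale (β j) (T j)

theorem measurable_prod_trunc {d : ℕ} (T : Fin d → ℝ) :
    Measurable fun x : Fin d → ℝ => ∏ j, trunc (x j) (T j) :=
  Finset.measurable_prod _ fun j _ => (measurable_trunc (T j)).comp (measurable_pi_apply j)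

theorem abs_prod_cut_le {d : ℕ} {T c : Fin d → ℝ} (hT : ∀ j, 0 ≤ T j) (hc : ∀ j, 0 ≤ c j)
    (p : (Fin d → ℝ) × (Fin d → ℝ)) :
    |∏ j, (trunc (p.1 j) (T j) + cut (c j) (p.2 j))| ≤ ∏ j, (T j + c j) := by
  rw [Finset.abs_prod]
  exact Finset.prod_le_prod (fun j _ => abs_nonneg _) fun j _ =>
    (abs_add_le _ _).trans (add_le_add (abs_trunc_le (hT j)) (abs_cut_le (hc j) _))

theorem integral_prod_cut {d : ℕ} (ν : Measure (Fin d → ℝ)) [IsProbabilityMeasure ν]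
    {T b c : Fin d → ℝ} (hb : ∀ j, 0 < b j) (hT : ∀ j, 0 ≤ T j) (hc : ∀ j, 0 ≤ c j) :
    ∫ p, ∏ j, (trunc (p.1 j) (T j) + cut (c j) (p.2 j))
      ∂(ν.prod (Measure.pi fun j => laplaceLaw (b j))) = truncMoment ν T := by
  have := fun j => isProbabilityMeasure_laplaceLaw (hb j)
  rw [integral_prod]
  · refine integral_congr_ae (ae_of_all _ fun x => ?_)
    change ∫ e : Fin d → ℝ, ∏ j, (trunc (x j) (T j) + cut (c j) (e j))
      ∂(Measure.pi fun j => laplaceLaw (b j)) = _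
    rw [integral_fintype_prod_eq_prod (fun j (e : ℝ) => trunc (x j) (T j) + cut (c j) e)]
    refine Finset.prod_congr rfl fun j _ => ?_
    have hci : Integrable (cut (c j)) (laplaceLaw (b j)) :=
      .of_bound (measurable_cut _).aestronglyMeasurable (c j) (ae_of_all _ (abs_cut_le (hc j)))
    rw [integral_add (integrable_const _) hci, integral_cut_laplaceLaw]
    simp
  · exact .of_bound (measurable_noisyProd T fun j => measurable_cut (c j)).aestronglyMeasurable _
      (ae_of_all _ (abs_prod_cut_le hT hc))

theorem integral_sq_prod_cut_le {d : ℕ} (ν : Measure (Fin d → ℝ)) [IsProbabilityMeasure ν]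
    {T b : Fin d → ℝ} (hb : ∀ j, 0 < b j) (hT : ∀ j, 0 ≤ T j) (hTb : ∀ j, T j ≤ b j)
    (c : Fin d → ℝ) :
    ∫ p, (∏ j, (trunc (p.1 j) (T j) + cut (c j) (p.2 j))) ^ 2
      ∂(ν.prod (Measure.pi fun j => laplaceLaw (b j))) ≤ 36 ^ d * (∏ j, b j) ^ 2 := by
  refine (integrable_prod_pi_laplaceLaw_of_le hb (K := fun j => 18 * b j ^ 2)
    (fun j => by positivity)
    ((measurable_noisyProd T fun j => measurable_cut (c j)).pow_const 2) fun p => ?_).2.trans_eq ?_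
  · rw [abs_of_nonneg (sq_nonneg _), ← Finset.prod_pow]
    exact Finset.prod_le_prod (fun j _ => sq_nonneg _) fun j _ =>
      sq_trunc_add_le (hT j) (hTb j) (hb j) (abs_cut_le_abs _ _)
  · rw [← Finset.prod_pow]
    simp only [Finset.prod_mul_distrib, Finset.prod_const, Finset.card_univ, Fintype.card_fin]
    rw [← mul_assoc, ← mul_pow]
    norm_num

theorem integrable_pow_four_noisyProd {d : ℕ} (ν : Measure (Fin d → ℝ)) [IsProbabilityMeasure ν]
    {T b : Fin d → ℝ} (hb : ∀ j, 0 < b j) (hT : ∀ j, 0 ≤ T j) (hTb : ∀ j, T j ≤ b j) :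
    Integrable (fun p : (Fin d → ℝ) × (Fin d → ℝ) => (∏ j, (trunc (p.1 j) (T j) + p.2 j)) ^ 4)
      (ν.prod (Measure.pi fun j => laplaceLaw (b j))) ∧
    ∫ p, (∏ j, (trunc (p.1 j) (T j) + p.2 j)) ^ 4
      ∂(ν.prod (Measure.pi fun j => laplaceLaw (b j))) ≤ 6160 ^ d * (∏ j, b j) ^ 4 := by
  have h := integrable_prod_pi_laplaceLaw_of_le (ν := ν) hb (K := fun j => 3080 * b j ^ 4)
    (fun j => by positivity)
    ((measurable_noisyProd T (g := fun _ e => e) fun j => measurable_id).pow_const 4) fun p => ?_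
  · refine ⟨h.1, h.2.trans_eq ?_⟩
    rw [← Finset.prod_pow]
    simp only [Finset.prod_mul_distrib, Finset.prod_const, Finset.card_univ, Fintype.card_fin]
    rw [← mul_assoc, ← mul_pow]
    norm_num
  · rw [abs_of_nonneg (Even.pow_nonneg ⟨2, rfl⟩ _), ← Finset.prod_pow]
    exact Finset.prod_le_prod (fun j _ => Even.pow_nonneg ⟨2, rfl⟩ _) fun j _ =>
      pow_four_trunc_add_le (hT j) (hTb j) (hb j)

/-! ### The law of the sample -/

/-- A product measure indexed by pairs is an iterated product measure. -/
theorem map_curry_pi {ι κ : Type*} [Fintype ι] [Fintype κ] {E : Type*} [MeasurableSpace E]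
    (μ : ι → κ → Measure E) [∀ i j, IsProbabilityMeasure (μ i j)] :
    (Measure.pi fun p : ι × κ => μ p.1 p.2).map (fun f i j => f (i, j)) =
      Measure.pi fun i => Measure.pi (μ i) := by
  have h : Measure.pi (fun p : ι × κ => μ p.1 p.2) =
      (Measure.pi fun i => Measure.pi (μ i)).map (fun (f : ι → κ → E) p => f p.1 p.2) := by
    refine Measure.pi_eq fun s hs => ?_
    rw [Measure.map_apply (by fun_prop) (MeasurableSet.univ_pi hs)]
    have : (fun (f : ι → κ → E) (p : ι × κ) => f p.1 p.2) ⁻¹' Set.univ.pi s =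
        Set.univ.pi fun i => Set.univ.pi fun j => s (i, j) := by
      ext f
      simp
    rw [this, Measure.pi_pi]
    simp only [Measure.pi_pi]
    exact (Fintype.prod_prod_type' fun i j => μ i j (s (i, j))).symm
  rw [h, Measure.map_map (by fun_prop) (by fun_prop)]
  exact Measure.map_id

section Sample

variable {Ω : Type*} [MeasurableSpace Ω] {P : Measure Ω} [IsProbabilityMeasure P] {d n : ℕ}
  {ν : Measure (Fin d → ℝ)} [IsProbabilityMeasure ν] {β : Fin d → ℝ}
  {X : Fin n → Ω → Fin d → ℝ} {ξ : Fin n → Fin d → grid n → Ω → ℝ}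

/-- For fixed truncation levels, the raw vectors paired with the noise used at these levels form
an iid sample of a product law. -/
theorem IsSample.hasLaw_pair (h : IsSample P ν β X ξ) (hn : 2 ≤ n) (hβ : ∀ j, 0 < β j)
    (T : Fin d → grid n) :
    HasLaw (fun ω i => (X i ω, fun j => ξ i j (T j) ω))
      (Measure.pi fun _ : Fin n =>
        ν.prod (Measure.pi fun j => laplaceLaw (noiseScale (β j) (T j)))) P := by
  have hprob := fun j => isProbabilityMeasure_laplaceLaw (noiseScale_pos hn (hβ j) (T j).2)
  have hX : HasLaw (fun ω i => X i ω) (Measure.pi fun _ : Fin n => ν) P :=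
    h.indep_raw.hasLaw_pi h.law_raw
  have hinj : Function.Injective fun p : Fin n × Fin d => (p.1, p.2, T p.2) := by
    rintro ⟨i, j⟩ ⟨i', j'⟩ hp
    simp only [Prod.mk.injEq] at hp
    simp [hp.1, hp.2.1]
  have hξ : HasLaw (fun ω (p : Fin n × Fin d) => ξ p.1 p.2 (T p.2) ω)
      (Measure.pi fun p : Fin n × Fin d => laplaceLaw (noiseScale (β p.2) (T p.2))) P :=
    (h.indep_noise.precomp hinj).hasLaw_pi fun p => h.law_noise p.1 p.2 (T p.2)
  have hcurry : HasLaw (fun (f : Fin n × Fin d → ℝ) i j => f (i, j))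
      (Measure.pi fun _ : Fin n => Measure.pi fun j => laplaceLaw (noiseScale (β j) (T j)))
      (Measure.pi fun p : Fin n × Fin d => laplaceLaw (noiseScale (β p.2) (T p.2))) :=
    ⟨Measurable.aemeasurable (by fun_prop),
      map_curry_pi fun (_ : Fin n) j => laplaceLaw (noiseScale (β j) (T j))⟩
  have hξ' := hcurry.comp hξ
  have hind : IndepFun (fun ω i => X i ω) (fun ω i j => ξ i j (T j) ω) P :=
    h.indep_raw_noise.comp (φ := id) (ψ := fun (f : Fin n → Fin d → grid n → ℝ) i j => f i j (T j))
      measurable_id (by fun_prop)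
  have hpair := hind.hasLaw_prod hX hξ'
  have harr := (measurePreserving_arrowProdEquivProdArrow (Fin d → ℝ) (Fin d → ℝ) (Fin n)
    (fun _ => ν) (fun _ => Measure.pi fun j => laplaceLaw (noiseScale (β j) (T j)))).symm
  exact harr.hasLaw.comp hpair

theorem IsSample.hasLaw_pair_apply (h : IsSample P ν β X ξ) (hn : 2 ≤ n) (hβ : ∀ j, 0 < β j)
    (T : Fin d → grid n) (i : Fin n) :
    HasLaw (fun ω => (X i ω, fun j => ξ i j (T j) ω))
      (ν.prod (Measure.pi fun j => laplaceLaw (noiseScale (β j) (T j)))) P := by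
  have hprob := fun j => isProbabilityMeasure_laplaceLaw (noiseScale_pos hn (hβ j) (T j).2)
  exact (measurePreserving_eval (fun _ : Fin n =>
    ν.prod (Measure.pi fun j => laplaceLaw (noiseScale (β j) (T j)))) i).hasLaw.comp
      (h.hasLaw_pair hn hβ T)

theorem IsSample.iIndepFun_pair (h : IsSample P ν β X ξ) (hn : 2 ≤ n) (hβ : ∀ j, 0 < β j)
    (T : Fin d → grid n) : iIndepFun (fun i ω => (X i ω, fun j => ξ i j (T j) ω)) P :=
  (iIndepFun_iff_hasLaw_pi_pi (h.hasLaw_pair_apply hn hβ T)).2 (h.hasLaw_pair hn hβ T)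

end Sample

/-! ### Concentration of the estimators with fixed truncation levels -/

theorem IsSample.aemeasurable_publicData {Ω : Type*} [MeasurableSpace Ω] {P : Measure Ω}
    {d n : ℕ} {ν : Measure (Fin d → ℝ)} {β : Fin d → ℝ} {X : Fin n → Ω → Fin d → ℝ}
    {ξ : Fin n → Fin d → grid n → Ω → ℝ} (h : IsSample P ν β X ξ) :
    AEMeasurable (publicData X ξ) P := by
  refine aemeasurable_pi_lambda _ fun i => aemeasurable_pi_lambda _ fun j =>
    aemeasurable_pi_lambda _ fun T => ?_
  exact ((measurable_trunc T).comp (measurable_pi_apply j)).comp_aemeasurable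
    (h.law_raw i).aemeasurable |>.add (h.law_noise i j T).aemeasurable

section Concentration

variable {Ω : Type*} [MeasurableSpace Ω] {P : Measure Ω} [IsProbabilityMeasure P] {d n : ℕ}
  {ν : Measure (Fin d → ℝ)} [IsProbabilityMeasure ν] {β : Fin d → ℝ}
  {X : Fin n → Ω → Fin d → ℝ} {ξ : Fin n → Fin d → grid n → Ω → ℝ}

theorem le_noiseScale {β T : ℝ} (hβ : 0 < β) (hβ1 : β ≤ 1) (hT : 0 ≤ T) : T ≤ noiseScale β T := by
  unfold noiseScale
  rw [le_div_iff₀ hβ]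
  nlinarith

theorem scaleProd_pos (hn : 2 ≤ n) (hβ : ∀ j, 0 < β j) (T : Fin d → grid n) :
    0 < scaleProd β fun j => (T j : ℝ) :=
  Finset.prod_pos fun j _ => noiseScale_pos hn (hβ j) (T j).2

theorem abs_truncMoment_le {T : Fin d → ℝ} (hT : ∀ j, 0 ≤ T j) :
    |truncMoment ν T| ≤ ∏ j, T j := by
  have h : ∀ x : Fin d → ℝ, ‖∏ j, trunc (x j) (T j)‖ ≤ ∏ j, T j := fun x => by
    rw [Real.norm_eq_abs, Finset.abs_prod]
    exact Finset.prod_le_prod (fun j _ => abs_nonneg _) fun j _ => abs_trunc_le (hT j)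
  unfold truncMoment
  simpa using norm_integral_le_of_norm_le_const (μ := ν) (ae_of_all _ h)

theorem IsSample.measureReal_cut_le (h : IsSample P ν β X ξ) (hn : 2 ≤ n) (hβ : ∀ j, 0 < β j)
    (hβ1 : ∀ j, β j ≤ 1) (T : Fin d → grid n) {a l : ℝ} (ha : 0 ≤ a) (hl : 0 ≤ l)
    (hla : l * (2 * (1 + a) ^ d * scaleProd β fun j => (T j : ℝ)) ≤ 1) (t : ℝ) :
    P.real {ω | t ≤ |1 / (n : ℝ) * ∑ i, ∏ j, (trunc (X i ω j) (T j) +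
        cut (a * noiseScale (β j) (T j)) (ξ i j (T j) ω)) - truncMoment ν fun j => (T j : ℝ)|} ≤
      2 * Real.exp (-(l * (n * t)) +
        n * (l ^ 2 * (36 ^ d * (scaleProd β fun j => (T j : ℝ)) ^ 2))) := by
  set s := scaleProd β fun j => (T j : ℝ) with hs
  set γ := truncMoment ν fun j => (T j : ℝ) with hγ
  have hn0 : (0 : ℝ) < n := by positivity
  have hb : ∀ j, 0 < noiseScale (β j) (T j) := fun j => noiseScale_pos hn (hβ j) (T j).2
  have hT : ∀ j, (0 : ℝ) ≤ T j := fun j => zero_le_one.trans (one_le_of_mem_grid hn (T j).2)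
  have hTb : ∀ j, (T j : ℝ) ≤ noiseScale (β j) (T j) := fun j =>
    le_noiseScale (hβ j) (hβ1 j) (hT j)
  have hc : ∀ j, 0 ≤ a * noiseScale (β j) (T j) := fun j => mul_nonneg ha (hb j).le
  have hprob := fun j => isProbabilityMeasure_laplaceLaw (hb j)
  set lam := ν.prod (Measure.pi fun j => laplaceLaw (noiseScale (β j) (T j))) with hlam
  set F : (Fin d → ℝ) × (Fin d → ℝ) → ℝ := fun p =>
    ∏ j, (trunc (p.1 j) (T j) + cut (a * noiseScale (β j) (T j)) (p.2 j)) with hF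
  have hFm : Measurable F := measurable_noisyProd _ fun j => measurable_cut _
  have hs0 : 0 < s := scaleProd_pos hn hβ T
  have hFs : ∀ p, |F p| ≤ (1 + a) ^ d * s := fun p => by
    refine (abs_prod_cut_le hT hc p).trans ?_
    calc ∏ j, ((T j : ℝ) + a * noiseScale (β j) (T j))
        ≤ ∏ j, ((1 + a) * noiseScale (β j) (T j)) :=
          Finset.prod_le_prod (fun j _ => add_nonneg (hT j) (hc j)) fun j _ => by
            have := hTb j
            linarith
      _ = (1 + a) ^ d * s := by
          rw [Finset.prod_mul_distrib, Finset.prod_const, Finset.card_univ, Fintype.card_fin]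
          rfl
  have hγs : |γ| ≤ (1 + a) ^ d * s := by
    refine (abs_truncMoment_le hT).trans ?_
    calc ∏ j, (T j : ℝ) ≤ s := Finset.prod_le_prod (fun j _ => hT j) fun j _ => hTb j
      _ ≤ (1 + a) ^ d * s := le_mul_of_one_le_left hs0.le (one_le_pow₀ (by linarith))
  have hFi : Integrable F lam := .of_bound hFm.aestronglyMeasurable _ (ae_of_all _ hFs)
  have hF2i : Integrable (fun p => F p ^ 2) lam :=
    .of_bound (hFm.pow_const 2).aestronglyMeasurable (((1 + a) ^ d * s) ^ 2)
      (ae_of_all _ fun p => by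
        rw [Real.norm_eq_abs, abs_pow]
        exact pow_le_pow_left₀ (abs_nonneg _) (hFs p) 2)
  have hmean : ∫ p, F p ∂lam = γ := integral_prod_cut ν hb hT hc
  have hGm : Measurable fun p => F p - γ := hFm.sub_const γ
  have hlaw := h.hasLaw_pair_apply hn hβ T
  -- the variance of the centred product is at most its second moment
  have hvar : ∫ p, (F p - γ) ^ 2 ∂lam ≤ 36 ^ d * s ^ 2 := by
    have h1 : ∀ p, (F p - γ) ^ 2 = F p ^ 2 - 2 * γ * F p + γ ^ 2 := fun p => by ring
    have h3 : Integrable (fun p => F p ^ 2 - 2 * γ * F p) lam := hF2i.sub (hFi.const_mul _)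
    simp only [h1]
    rw [integral_add h3 (integrable_const _),
      integral_sub hF2i (hFi.const_mul _), integral_const_mul, hmean]
    have h2 : ∫ p, F p ^ 2 ∂lam ≤ 36 ^ d * s ^ 2 := integral_sq_prod_cut_le ν hb hT hTb _
    simp only [integral_const, probReal_univ, one_smul]
    nlinarith [sq_nonneg γ]
  have key := measureReal_le_abs_sum_le (P := P) (B := 2 * (1 + a) ^ d * s) (v := 36 ^ d * s ^ 2)
    (Y := fun i ω => F (X i ω, fun j => ξ i j (T j) ω) - γ)
    ((h.iIndepFun_pair hn hβ T).comp (fun _ p => F p - γ) fun _ => hGm)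
    (fun i => hGm.comp_aemeasurable (hlaw i).aemeasurable)
    (fun i ω => by
      have h1 := hFs (X i ω, fun j => ξ i j (T j) ω)
      have h2 := abs_sub (F (X i ω, fun j => ξ i j (T j) ω)) γ
      linarith)
    (fun i => by
      have := (hlaw i).integral_comp hGm.aestronglyMeasurable
      simp only [Function.comp_def] at this
      rw [this, integral_sub hFi (integrable_const _), hmean]
      simp)
    (fun i => by
      have := (hlaw i).integral_comp (hGm.pow_const 2).aestronglyMeasurable
      simp only [Function.comp_def] at this
      rw [this]
      exact hvar)
    hl hla (n * t)
  refine (measureReal_mono fun ω hω => ?_).trans key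
  simp only [Set.mem_ofPred_eq, Finset.sum_sub_distrib, Finset.sum_const, Finset.card_univ,
    Fintype.card_fin, nsmul_eq_mul] at hω ⊢
  have : ∑ i, F (X i ω, fun j => ξ i j (T j) ω) - n * γ =
      n * (1 / (n : ℝ) * ∑ i, F (X i ω, fun j => ξ i j (T j) ω) - γ) := by
    field_simp
  rw [this, abs_mul, abs_of_pos hn0]
  exact mul_le_mul_of_nonneg_left hω hn0.le

/-- The admissible range of the exponential inequality: `√(log n / n)` beats every power of
`log n`. -/
theorem exists_sqrt_log_mul_le (d : ℕ) {A : ℝ} (hA : 1 ≤ A) : ∃ K : ℝ, 0 < K ∧ ∀ n : ℕ, 1 ≤ n →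
    2 * Real.sqrt (Real.log n / n) * (1 + A * Real.log n) ^ d ≤ K := by
  set Q : ℝ := A ^ (2 * d + 1) * (Nat.factorial (2 * d + 1) : ℝ) * Real.exp (1 / A) with hQ
  have hQ0 : 0 < Q := by positivity
  refine ⟨2 * Real.sqrt Q, by positivity, fun n hn => ?_⟩
  have hn0 : (0 : ℝ) < n := by exact_mod_cast hn
  have hlog : 0 ≤ Real.log n := Real.log_natCast_nonneg n
  set u := 1 + A * Real.log n with hu
  have hu0 : 0 < u := by positivity
  have hlu : Real.log n ≤ u := by nlinarith
  have h1 := Real.pow_div_factorial_le_exp (x := u / A) (by positivity) (2 * d + 1)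
  have h2 : Real.exp (u / A) = Real.exp (1 / A) * n := by
    rw [show u / A = 1 / A + Real.log n by rw [hu]; field_simp, Real.exp_add, Real.exp_log hn0]
  have h3 : u ^ (2 * d + 1) ≤ Q * n := by
    rw [h2, div_pow, div_div, div_le_iff₀ (by positivity)] at h1
    calc u ^ (2 * d + 1) ≤ _ := h1
      _ = Q * n := by rw [hQ]; ring
  rw [mul_assoc]
  refine mul_le_mul_of_nonneg_left ?_ two_pos.le
  refine Real.le_sqrt_of_sq_le ?_
  rw [mul_pow, Real.sq_sqrt (by positivity), ← pow_mul, div_mul_eq_mul_div, div_le_iff₀ hn0]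
  calc Real.log n * u ^ (d * 2) ≤ u * u ^ (d * 2) := by gcongr
    _ = u ^ (2 * d + 1) := by ring
    _ ≤ Q * n := h3

theorem scaleProd_sq (β T : Fin d → ℝ) :
    scaleProd β T ^ 2 = 4 ^ d * ((∏ j, T j ^ 2) / ∏ j, β j ^ 2) := by
  unfold scaleProd noiseScale
  rw [← Finset.prod_pow, ← Finset.prod_div_distrib]
  have : ∀ j, (2 * T j / β j) ^ 2 = 4 * (T j ^ 2 / β j ^ 2) := fun j => by ring
  simp only [this, Finset.prod_mul_distrib, Finset.prod_const, Finset.card_univ, Fintype.card_fin]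

theorem card_grid_le_self (n : ℕ) : (grid n).card ≤ n :=
  (card_grid_le n).trans (Nat.log_le_self 2 n)

/-- With probability polynomially close to one, simultaneously for all truncation levels, the
squared deviation of the estimator from its mean is at most a sixth of the penalty. -/
theorem exists_measureReal_deviation_le (d : ℕ) {b : ℝ} (hb : 0 < b) : ∃ C₀ : ℝ, 0 < C₀ ∧
    ∀ c₀ : ℝ, C₀ ≤ c₀ → ∀ (n : ℕ), 2 ≤ n → ∀ (ν : Measure (Fin d → ℝ)) [IsProbabilityMeasure ν]
      (β : Fin d → ℝ), (∀ j, 0 < β j) → (∀ j, β j ≤ 1) →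
      ∀ {Ω : Type*} [MeasurableSpace Ω] (P : Measure Ω) [IsProbabilityMeasure P]
        (X : Fin n → Ω → Fin d → ℝ) (ξ : Fin n → Fin d → grid n → Ω → ℝ), IsSample P ν β X ξ →
      P.real {ω | ∃ T : Fin d → grid n, penalty (c₀ * Real.log n) β T / 6 <
          (momentEst (publicData X ξ ω) T - truncMoment ν fun j => (T j : ℝ)) ^ 2} ≤
        (2 * d + 2) * (n : ℝ) ^ ((d : ℝ) - b) := by
  -- cutting the noise at `A * log n` scales costs `2 * n ^ (-(b + 2))` per noise variable, and
  -- there are at most `d * n ^ 2` of them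
  set A : ℝ := 2 * (b + 2) with hA
  obtain ⟨K, hK, hKn⟩ := exists_sqrt_log_mul_le d (A := A) (by linarith)
  -- with `l = r / (K s)` and deviation `τ s r` below, the exponent of the exponential inequality
  -- is `-(τ / K - 36 ^ d / K ^ 2) * log n = -b * log n`
  set τ : ℝ := K * b + 36 ^ d / K with hτ
  have hτ0 : 0 < τ := by positivity
  refine ⟨6 * 4 ^ d * τ ^ 2, by positivity, ?_⟩
  intro c₀ hc₀ n hn ν _ β hβ hβ1 Ω _ P _ X ξ h
  have hn0 : (0 : ℝ) < n := by positivity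
  have hn1 : (1 : ℝ) ≤ n := by exact_mod_cast (by omega : 1 ≤ n)
  have hlog : 0 ≤ Real.log n := Real.log_natCast_nonneg n
  set r := Real.sqrt (Real.log n / n) with hr
  have hr2 : r ^ 2 = Real.log n / n := Real.sq_sqrt (by positivity)
  have hr0 : 0 ≤ r := Real.sqrt_nonneg _
  set E1 : Fin n × Fin d × grid n → Set Ω := fun q =>
    {ω | A * Real.log n * noiseScale (β q.2.1) q.2.2 < |ξ q.1 q.2.1 q.2.2 ω|} with hE1
  set E2 : (Fin d → grid n) → Set Ω := fun T =>
    {ω | τ * (scaleProd β fun j => (T j : ℝ)) * r ≤ |1 / (n : ℝ) * ∑ i, ∏ j,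
      (trunc (X i ω j) (T j) + cut (A * Real.log n * noiseScale (β j) (T j)) (ξ i j (T j) ω)) -
        truncMoment ν fun j => (T j : ℝ)|} with hE2
  have hsub : {ω | ∃ T : Fin d → grid n, penalty (c₀ * Real.log n) β T / 6 <
      (momentEst (publicData X ξ ω) T - truncMoment ν fun j => (T j : ℝ)) ^ 2} ⊆
      (⋃ q, E1 q) ∪ ⋃ T, E2 T := by
    rintro ω ⟨T, hT⟩
    by_contra hω
    simp only [Set.mem_union, Set.mem_iUnion, not_or, not_exists, hE1, hE2, Set.mem_ofPred_eq,
      not_lt, not_le] at hω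
    obtain ⟨hω1, hω2⟩ := hω
    have hcut : ∀ i j, cut (A * Real.log n * noiseScale (β j) (T j)) (ξ i j (T j) ω) =
        ξ i j (T j) ω := fun i j => cut_of_abs_le (hω1 (i, j, T j))
    have h2 := hω2 T
    simp only [hcut] at h2
    have h3 : |momentEst (publicData X ξ ω) T - truncMoment ν fun j => (T j : ℝ)| ^ 2 ≤
        (τ * (scaleProd β fun j => (T j : ℝ)) * r) ^ 2 :=
      pow_le_pow_left₀ (abs_nonneg _) h2.le 2
    rw [sq_abs] at h3
    have h4 : (τ * (scaleProd β fun j => (T j : ℝ)) * r) ^ 2 ≤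
        penalty (c₀ * Real.log n) β T / 6 := by
      rw [mul_pow, mul_pow, hr2, scaleProd_sq]
      unfold penalty
      have hq : 0 ≤ Real.log n * ((∏ j, (T j : ℝ) ^ 2) / (n * ∏ j, β j ^ 2)) :=
        mul_nonneg hlog (div_nonneg (Finset.prod_nonneg fun j _ => sq_nonneg _)
          (mul_nonneg hn0.le (Finset.prod_nonneg fun j _ => sq_nonneg _)))
      calc τ ^ 2 * (4 ^ d * ((∏ j, (T j : ℝ) ^ 2) / ∏ j, β j ^ 2)) * (Real.log n / n)
          = (4 ^ d * τ ^ 2) *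
            (Real.log n * ((∏ j, (T j : ℝ) ^ 2) / (n * ∏ j, β j ^ 2))) := by
            field_simp
        _ ≤ c₀ / 6 * (Real.log n * ((∏ j, (T j : ℝ) ^ 2) / (n * ∏ j, β j ^ 2))) := by
            refine mul_le_mul_of_nonneg_right ?_ hq
            linarith
        _ = _ := by ring
    linarith
  have hP1 : ∀ q, P.real (E1 q) ≤ 2 * (n : ℝ) ^ (-(b + 2)) := by
    intro q
    have hms : MeasurableSet {e : ℝ | A * Real.log n * noiseScale (β q.2.1) q.2.2 < |e|} :=
      measurableSet_lt measurable_const (by fun_prop)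
    rw [hE1, (h.law_noise q.1 q.2.1 q.2.2).measureReal_eq hms]
    refine (measureReal_laplaceLaw_lt_abs_le (noiseScale_pos hn (hβ _) q.2.2.2) _).trans_eq ?_
    rw [Real.rpow_def_of_pos hn0]
    congr 2
    rw [hA]
    ring
  have hP2 : ∀ T, P.real (E2 T) ≤ 2 * (n : ℝ) ^ (-b) := by
    intro T
    have hs0 : 0 < scaleProd β fun j => (T j : ℝ) := scaleProd_pos hn hβ T
    set s := scaleProd β fun j => (T j : ℝ) with hs
    have hl : r / (K * s) * (2 * (1 + A * Real.log n) ^ d * s) ≤ 1 := by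
      have := hKn n (by omega)
      rw [div_mul_eq_mul_div, div_le_one (by positivity)]
      nlinarith
    refine (h.measureReal_cut_le hn hβ hβ1 T (a := A * Real.log n) (l := r / (K * s))
      (by positivity) (by positivity) hl _).trans_eq ?_
    rw [Real.rpow_def_of_pos hn0]
    congr 2
    rw [← hs]
    have e1 : r / (K * s) * (n * (τ * s * r)) = r ^ 2 * n * τ / K := by
      field_simp
    have e2 : n * ((r / (K * s)) ^ 2 * (36 ^ d * s ^ 2)) = r ^ 2 * n * 36 ^ d / K ^ 2 := by
      field_simp
    rw [e1, e2, hr2, hτ]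
    field_simp
    ring
  have hcard : ((grid n).card : ℝ) ≤ n := by exact_mod_cast card_grid_le_self n
  have hU1 : P.real (⋃ q, E1 q) ≤ 2 * d * (n : ℝ) ^ ((d : ℝ) - b) := by
    calc P.real (⋃ q, E1 q) ≤ ∑ q, P.real (E1 q) := measureReal_iUnion_fintype_le _
      _ ≤ ∑ _q : Fin n × Fin d × grid n, 2 * (n : ℝ) ^ (-(b + 2)) :=
          Finset.sum_le_sum fun q _ => hP1 q
      _ = n * (d * (grid n).card) * (2 * (n : ℝ) ^ (-(b + 2))) := by
          simp
      _ ≤ n * (d * n) * (2 * (n : ℝ) ^ (-(b + 2))) := by gcongr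
      _ = 2 * d * (n : ℝ) ^ (-b) := by
          rw [neg_add, Real.rpow_add hn0, Real.rpow_neg hn0.le 2, Real.rpow_two]
          field_simp
      _ ≤ 2 * d * (n : ℝ) ^ ((d : ℝ) - b) := by
          gcongr
          have : (0 : ℝ) ≤ d := by positivity
          linarith
  have hU2 : P.real (⋃ T, E2 T) ≤ 2 * (n : ℝ) ^ ((d : ℝ) - b) := by
    calc P.real (⋃ T, E2 T) ≤ ∑ T, P.real (E2 T) := measureReal_iUnion_fintype_le _
      _ ≤ ∑ _T : Fin d → grid n, 2 * (n : ℝ) ^ (-b) := Finset.sum_le_sum fun T _ => hP2 T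
      _ = ((grid n).card : ℝ) ^ d * (2 * (n : ℝ) ^ (-b)) := by
          simp
      _ ≤ (n : ℝ) ^ d * (2 * (n : ℝ) ^ (-b)) := by gcongr
      _ = 2 * (n : ℝ) ^ ((d : ℝ) - b) := by
          rw [sub_eq_add_neg, Real.rpow_add hn0, Real.rpow_natCast]
          ring
  calc _ ≤ P.real ((⋃ q, E1 q) ∪ ⋃ T, E2 T) := measureReal_mono hsub
    _ ≤ _ := measureReal_union_le _ _
    _ ≤ _ := add_le_add hU1 hU2
    _ = _ := by ring

theorem IsSample.integrable_momentEst_pow_four (h : IsSample P ν β X ξ) (hn : 2 ≤ n)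
    (hβ : ∀ j, 0 < β j) (hβ1 : ∀ j, β j ≤ 1) (T : Fin d → grid n) :
    Integrable (fun ω => momentEst (publicData X ξ ω) T ^ 4) P ∧
      ∫ ω, momentEst (publicData X ξ ω) T ^ 4 ∂P ≤
        6160 ^ d * (scaleProd β fun j => (T j : ℝ)) ^ 4 := by
  have hn0 : (0 : ℝ) < n := by positivity
  have hb : ∀ j, 0 < noiseScale (β j) (T j) := fun j => noiseScale_pos hn (hβ j) (T j).2
  have hT : ∀ j, (0 : ℝ) ≤ T j := fun j => zero_le_one.trans (one_le_of_mem_grid hn (T j).2)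
  have hTb : ∀ j, (T j : ℝ) ≤ noiseScale (β j) (T j) := fun j =>
    le_noiseScale (hβ j) (hβ1 j) (hT j)
  set F : (Fin d → ℝ) × (Fin d → ℝ) → ℝ := fun p => ∏ j, (trunc (p.1 j) (T j) + p.2 j) with hF
  have hFm : Measurable F := measurable_noisyProd _ (g := fun _ e => e) fun j => measurable_id
  have hlaw := h.hasLaw_pair_apply hn hβ T
  obtain ⟨hi, hle⟩ := integrable_pow_four_noisyProd ν hb hT hTb
  have hYm : ∀ i, AEMeasurable (fun ω => F (X i ω, fun j => ξ i j (T j) ω)) P := fun i =>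
    hFm.comp_aemeasurable (hlaw i).aemeasurable
  have hYi : ∀ i, Integrable (fun ω => F (X i ω, fun j => ξ i j (T j) ω) ^ 4) P := fun i => by
    have := (hlaw i).map_eq ▸ hi
    exact this.comp_aemeasurable (hlaw i).aemeasurable
  have hYle : ∀ i, ∫ ω, F (X i ω, fun j => ξ i j (T j) ω) ^ 4 ∂P ≤
      6160 ^ d * (scaleProd β fun j => (T j : ℝ)) ^ 4 := fun i => by
    have := (hlaw i).integral_comp (hFm.pow_const 4).aestronglyMeasurable
    simp only [Function.comp_def] at this
    rw [this]
    exact hle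
  have hest : ∀ ω, momentEst (publicData X ξ ω) T =
      ∑ i, 1 / (n : ℝ) * F (X i ω, fun j => ξ i j (T j) ω) := fun ω => by
    rw [← Finset.mul_sum]
    rfl
  have hpow : ∀ ω, momentEst (publicData X ξ ω) T ^ 4 ≤
      ∑ i, 1 / (n : ℝ) * F (X i ω, fun j => ξ i j (T j) ω) ^ 4 := fun ω => by
    rw [hest]
    refine Real.pow_arith_mean_le_arith_mean_pow_of_even _ _ _ (fun i _ => by positivity) ?_
      ⟨2, rfl⟩
    simp
    field_simp
  have hsum : Integrable (fun ω => ∑ i, 1 / (n : ℝ) * F (X i ω, fun j => ξ i j (T j) ω) ^ 4) P :=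
    integrable_finsetSum _ fun i _ => (hYi i).const_mul _
  have hint : Integrable (fun ω => momentEst (publicData X ξ ω) T ^ 4) P := by
    refine hsum.mono' (AEMeasurable.aestronglyMeasurable ?_) (ae_of_all _ fun ω => ?_)
    · simp only [hest]
      exact (Finset.univ.aemeasurable_fun_sum fun i _ => (hYm i).const_mul _).pow_const 4
    · rw [Real.norm_eq_abs, abs_of_nonneg (Even.pow_nonneg ⟨2, rfl⟩ _)]
      exact hpow ω
  refine ⟨hint, (integral_mono hint hsum hpow).trans ?_⟩
  rw [integral_finsetSum _ fun i _ => (hYi i).const_mul _]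
  calc ∑ i, ∫ ω, 1 / (n : ℝ) * F (X i ω, fun j => ξ i j (T j) ω) ^ 4 ∂P
      ≤ ∑ _i : Fin n, 1 / (n : ℝ) * (6160 ^ d * (scaleProd β fun j => (T j : ℝ)) ^ 4) :=
        Finset.sum_le_sum fun i _ => by
          rw [integral_const_mul]
          exact mul_le_mul_of_nonneg_left (hYle i) (by positivity)
    _ = _ := by
        simp
        field_simp

theorem measurable_momentEst_selector {S : (Fin n → Fin d → grid n → ℝ) → Fin d → grid n}
    (hS : Measurable S) : Measurable fun z => momentEst z (S z) := by
  have h : Measurable fun p : (Fin n → Fin d → grid n → ℝ) × (Fin d → grid n) =>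
      momentEst p.1 p.2 := by
    refine measurable_from_prod_countable_left fun T => ?_
    change Measurable fun z : Fin n → Fin d → grid n → ℝ => 1 / (n : ℝ) * ∑ i, ∏ j, z i j (T j)
    fun_prop
  exact h.comp (measurable_id.prodMk hS)

end Concentration

/-! ### The bias of truncation -/

section Bias

variable {d : ℕ}

/-- The exponent `1 + k j * (1 - ∑ 1 / k)` at `i = j`, and `1` at the other indices. Dividing the
`i`-th exponent by `k i` gives weights of sum one, as Hölder's inequality asks: all the
integrability left over by `∑ 1 / k < 1` is spent on coordinate `j`. -/
noncomputable def momentExp (k : Fin d → ℝ) (i j : Fin d) : ℝ :=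
  1 + if i = j then k j * (1 - ∑ l, 1 / k l) else 0

/-- The product of the powers `|x i| ^ momentExp k i j`. -/
noncomputable def momentMajorant (k : Fin d → ℝ) (j : Fin d) (x : Fin d → ℝ) : ℝ :=
  ∏ i, |x i| ^ momentExp k i j

/-- The Hölder bound for the integral of `momentMajorant k j` when the `k i`-norms are at most
`M`. -/
noncomputable def momentConst (k : Fin d → ℝ) (M : ℝ≥0) (j : Fin d) : ℝ :=
  ∏ i, (M : ℝ) ^ momentExp k i j

/-- A bound on the bias caused by the truncation levels `T`. -/
noncomputable def biasBound (k : Fin d → ℝ) (M : ℝ≥0) (T : Fin d → ℝ) : ℝ :=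
  ∑ j, 2 * T j ^ (-(k j * (1 - ∑ l, 1 / k l))) * momentConst k M j

variable {k : Fin d → ℝ}

theorem one_le_momentExp (hk : ∀ j, 1 < k j) (hk1 : ∑ j, 1 / k j < 1) (i j : Fin d) :
    1 ≤ momentExp k i j := by
  unfold momentExp
  have : 0 < k j * (1 - ∑ l, 1 / k l) := mul_pos (by linarith [hk j]) (by linarith)
  split_ifs <;> linarith

theorem sum_momentExp_div (hk : ∀ j, 1 < k j) (j : Fin d) : ∑ i, momentExp k i j / k i = 1 := by
  have h : ∀ i, momentExp k i j / k i = 1 / k i + if i = j then 1 - ∑ l, 1 / k l else 0 := by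
    intro i
    have hi : k i ≠ 0 := by linarith [hk i]
    unfold momentExp
    split_ifs with hij
    · subst hij
      field_simp
    · simp
  simp only [h, Finset.sum_add_distrib, Finset.sum_ite_eq', Finset.mem_univ, if_true]
  ring

theorem momentConst_nonneg (k : Fin d → ℝ) (M : ℝ≥0) (j : Fin d) : 0 ≤ momentConst k M j :=
  Finset.prod_nonneg fun _ _ => Real.rpow_nonneg M.coe_nonneg _

theorem momentMajorant_nonneg (k : Fin d → ℝ) (j : Fin d) (x : Fin d → ℝ) :
    0 ≤ momentMajorant k j x :=
  Finset.prod_nonneg fun _ _ => Real.rpow_nonneg (abs_nonneg _) _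

theorem measurable_momentMajorant (k : Fin d → ℝ) (j : Fin d) :
    Measurable (momentMajorant k j) := by
  unfold momentMajorant
  fun_prop

theorem momentMajorant_eq (hk : ∀ j, 1 < k j) (hk1 : ∑ j, 1 / k j < 1) (j : Fin d)
    (x : Fin d → ℝ) :
    momentMajorant k j x = |x j| ^ (k j * (1 - ∑ l, 1 / k l)) * ∏ i, |x i| := by
  have hρ : 0 < k j * (1 - ∑ l, 1 / k l) := mul_pos (by linarith [hk j]) (by linarith)
  have h : ∀ i, |x i| ^ momentExp k i j =
      |x i| * if i = j then |x j| ^ (k j * (1 - ∑ l, 1 / k l)) else 1 := by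
    intro i
    unfold momentExp
    split_ifs with hij
    · subst hij
      rw [Real.rpow_add_of_nonneg (abs_nonneg _) zero_le_one hρ.le, Real.rpow_one]
    · simp
  unfold momentMajorant
  simp only [h, Finset.prod_mul_distrib, Finset.prod_ite_eq', Finset.mem_univ, if_true]
  ring

theorem integrable_momentMajorant (hk : ∀ j, 1 < k j) (hk1 : ∑ j, 1 / k j < 1) {M : ℝ≥0}
    {ν : Measure (Fin d → ℝ)}
    (hν : ∀ j, eLpNorm (fun x : Fin d → ℝ => x j) (ENNReal.ofReal (k j)) ν ≤ M) (j : Fin d) :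
    Integrable (momentMajorant k j) ν ∧ ∫ x, momentMajorant k j x ∂ν ≤ momentConst k M j := by
  have hmom : ∀ i, ∫⁻ x, ‖x i‖ₑ ^ k i ∂ν ≤ (M : ℝ≥0∞) ^ k i := by
    intro i
    have hi : 0 < k i := by linarith [hk i]
    have h := hν i
    rw [eLpNorm_eq_lintegral_rpow_enorm_toReal (by simpa using hi) ENNReal.ofReal_ne_top,
      ENNReal.toReal_ofReal hi.le] at h
    have := ENNReal.rpow_le_rpow h hi.le
    rwa [← ENNReal.rpow_mul, one_div_mul_cancel hi.ne', ENNReal.rpow_one] at this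
  have hpt : ∀ x : Fin d → ℝ, ENNReal.ofReal (momentMajorant k j x) =
      ∏ i, (‖x i‖ₑ ^ k i) ^ (momentExp k i j / k i) := by
    intro x
    unfold momentMajorant
    rw [ENNReal.ofReal_prod_of_nonneg fun i _ => Real.rpow_nonneg (abs_nonneg _) _]
    refine Finset.prod_congr rfl fun i _ => ?_
    have hi : k i ≠ 0 := by linarith [hk i]
    have he := one_le_momentExp hk hk1 i j
    rw [← ENNReal.rpow_mul, mul_div_cancel₀ _ hi, ← ENNReal.ofReal_rpow_of_nonneg (abs_nonneg _)
      (by linarith), ← Real.norm_eq_abs, ofReal_norm]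
  have hle : ∫⁻ x, ENNReal.ofReal (momentMajorant k j x) ∂ν ≤
      ENNReal.ofReal (momentConst k M j) := by
    calc ∫⁻ x, ENNReal.ofReal (momentMajorant k j x) ∂ν
        = ∫⁻ x, ∏ i, (‖x i‖ₑ ^ k i) ^ (momentExp k i j / k i) ∂ν := lintegral_congr hpt
      _ ≤ ∏ i, (∫⁻ x, ‖x i‖ₑ ^ k i ∂ν) ^ (momentExp k i j / k i) := by
          refine ENNReal.lintegral_prod_norm_pow_le _
            (f := fun i (x : Fin d → ℝ) => ‖x i‖ₑ ^ k i)
            (fun i _ => Measurable.aemeasurable (by fun_prop))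
            (sum_momentExp_div hk j) fun i _ => ?_
          have := one_le_momentExp hk hk1 i j
          exact div_nonneg (by linarith) (by linarith [hk i])
      _ ≤ ∏ i, ((M : ℝ≥0∞) ^ k i) ^ (momentExp k i j / k i) := by
          refine Finset.prod_le_prod' fun i _ => ENNReal.rpow_le_rpow (hmom i) ?_
          have := one_le_momentExp hk hk1 i j
          exact div_nonneg (by linarith) (by linarith [hk i])
      _ = ENNReal.ofReal (momentConst k M j) := by
          unfold momentConst
          rw [ENNReal.ofReal_prod_of_nonneg fun i _ => Real.rpow_nonneg M.coe_nonneg _]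
          refine Finset.prod_congr rfl fun i _ => ?_
          have hi : k i ≠ 0 := by linarith [hk i]
          have he := one_le_momentExp hk hk1 i j
          rw [← ENNReal.rpow_mul, mul_div_cancel₀ _ hi,
            ← ENNReal.ofReal_rpow_of_nonneg M.coe_nonneg (by linarith), ENNReal.ofReal_coe_nnreal]
  have hm := (measurable_momentMajorant k j).aestronglyMeasurable (μ := ν)
  refine ⟨⟨hm, ?_⟩, ?_⟩
  · rw [hasFiniteIntegral_iff_ofReal (ae_of_all _ (momentMajorant_nonneg k j))]
    exact hle.trans_lt ENNReal.ofReal_lt_top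
  · rw [integral_eq_lintegral_of_nonneg_ae (ae_of_all _ (momentMajorant_nonneg k j)) hm]
    exact ENNReal.toReal_le_of_le_ofReal (momentConst_nonneg k M j) hle

theorem prod_abs_le_of_lt (hk : ∀ j, 1 < k j) (hk1 : ∑ j, 1 / k j < 1) {x : Fin d → ℝ} {j : Fin d}
    {t : ℝ} (ht : 0 < t) (hx : t < |x j|) :
    ∏ i, |x i| ≤ t ^ (-(k j * (1 - ∑ l, 1 / k l))) * momentMajorant k j x := by
  have hρ : 0 < k j * (1 - ∑ l, 1 / k l) := mul_pos (by linarith [hk j]) (by linarith)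
  rw [momentMajorant_eq hk hk1, ← mul_assoc]
  refine le_mul_of_one_le_left (Finset.prod_nonneg fun i _ => abs_nonneg _) ?_
  rw [Real.rpow_neg ht.le, inv_mul_eq_div, one_le_div (by positivity)]
  exact Real.rpow_le_rpow ht.le hx.le hρ.le

theorem prod_abs_le (hk : ∀ j, 1 < k j) (hk1 : ∑ j, 1 / k j < 1) (x : Fin d → ℝ) :
    ∏ i, |x i| ≤ 1 + ∑ j, momentMajorant k j x := by
  by_cases h : ∀ j, |x j| ≤ 1
  · have h1 := Finset.prod_le_one (s := Finset.univ) (fun i _ => abs_nonneg (x i)) fun i _ => h i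
    have h2 := Finset.sum_nonneg (s := Finset.univ) fun j _ => momentMajorant_nonneg k j x
    linarith
  · push Not at h
    obtain ⟨j, hj⟩ := h
    have h1 := prod_abs_le_of_lt hk hk1 one_pos hj
    rw [Real.one_rpow, one_mul] at h1
    have h2 := Finset.single_le_sum (fun j _ => momentMajorant_nonneg k j x) (Finset.mem_univ j)
    linarith

/-- Two products whose factors are dominated by `|x j|`, and agree whenever `|x j| ≤ T j`, differ
only if some `|x j|` exceeds `T j`; then the product of the `|x i|` is small compared with a
higher moment. -/
theorem abs_prod_sub_prod_le (hk : ∀ j, 1 < k j) (hk1 : ∑ j, 1 / k j < 1) {x a b T : Fin d → ℝ}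
    (hT : ∀ j, 0 < T j) (ha : ∀ j, |a j| ≤ |x j|) (hb : ∀ j, |b j| ≤ |x j|)
    (hab : ∀ j, |x j| ≤ T j → a j = b j) :
    |∏ j, a j - ∏ j, b j| ≤
      ∑ j, 2 * T j ^ (-(k j * (1 - ∑ l, 1 / k l))) * momentMajorant k j x := by
  have hterm : ∀ j, 0 ≤ 2 * T j ^ (-(k j * (1 - ∑ l, 1 / k l))) * momentMajorant k j x := fun j =>
    mul_nonneg (mul_nonneg two_pos.le (Real.rpow_nonneg (hT j).le _)) (momentMajorant_nonneg k j x)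
  by_cases h : ∀ j, |x j| ≤ T j
  · rw [Finset.prod_congr rfl fun j _ => hab j (h j), sub_self, abs_zero]
    exact Finset.sum_nonneg fun j _ => hterm j
  · push Not at h
    obtain ⟨j, hj⟩ := h
    have h1 : |∏ j, a j| ≤ ∏ i, |x i| := by
      rw [Finset.abs_prod]
      exact Finset.prod_le_prod (fun i _ => abs_nonneg _) fun i _ => ha i
    have h2 : |∏ j, b j| ≤ ∏ i, |x i| := by
      rw [Finset.abs_prod]
      exact Finset.prod_le_prod (fun i _ => abs_nonneg _) fun i _ => hb i
    have h3 := prod_abs_le_of_lt hk hk1 (hT j) hj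
    have h4 := Finset.single_le_sum (fun j _ => hterm j) (Finset.mem_univ j)
    have h5 := abs_sub (∏ j, a j) (∏ j, b j)
    calc |∏ j, a j - ∏ j, b j| ≤ 2 * ∏ i, |x i| := by linarith
      _ ≤ 2 * (T j ^ (-(k j * (1 - ∑ l, 1 / k l))) * momentMajorant k j x) := by gcongr
      _ ≤ _ := by rw [← mul_assoc]; exact h4

theorem abs_trunc_le_abs (x : ℝ) {T : ℝ} (hT : 0 ≤ T) : |trunc x T| ≤ |x| := by
  unfold trunc
  rw [abs_le]
  refine ⟨?_, max_le ((min_le_left _ _).trans (le_abs_self x))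
    ((neg_nonpos.2 hT).trans (abs_nonneg x))⟩
  rcases le_total x T with h | h
  · rw [min_eq_left h]
    exact (neg_abs_le x).trans (le_max_left _ _)
  · rw [min_eq_right h]
    exact ((neg_nonpos.2 (abs_nonneg x)).trans hT).trans (le_max_left _ _)

theorem trunc_of_abs_le {x T : ℝ} (h : |x| ≤ T) : trunc x T = x := by
  unfold trunc
  rw [min_eq_left (abs_le.1 h).2, max_eq_left (abs_le.1 h).1]

theorem trunc_min_of_abs_le {x T : ℝ} (T' : ℝ) (h : |x| ≤ T) :
    trunc x (min T T') = trunc x T' := by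
  rcases le_total T T' with h' | h'
  · rw [min_eq_left h', trunc_of_abs_le h, trunc_of_abs_le (h.trans h')]
  · rw [min_eq_right h']

variable {ν : Measure (Fin d → ℝ)} {M : ℝ≥0}

theorem abs_integral_sub_integral_le (hk : ∀ j, 1 < k j) (hk1 : ∑ j, 1 / k j < 1)
    (hν : ∀ j, eLpNorm (fun x : Fin d → ℝ => x j) (ENNReal.ofReal (k j)) ν ≤ M)
    {f g : (Fin d → ℝ) → ℝ} (hf : Integrable f ν) (hg : Integrable g ν) {T : Fin d → ℝ}
    (hT : ∀ j, 0 < T j)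
    (h : ∀ x, |f x - g x| ≤
      ∑ j, 2 * T j ^ (-(k j * (1 - ∑ l, 1 / k l))) * momentMajorant k j x) :
    |∫ x, f x ∂ν - ∫ x, g x ∂ν| ≤ biasBound k M T := by
  have hi := integrable_momentMajorant hk hk1 hν
  rw [← integral_sub hf hg, ← Real.norm_eq_abs]
  refine (norm_integral_le_of_norm_le (integrable_finsetSum _ fun j _ => (hi j).1.const_mul _)
    (ae_of_all _ h)).trans ?_
  rw [integral_finsetSum _ fun j _ => (hi j).1.const_mul _]
  refine Finset.sum_le_sum fun j _ => ?_
  rw [integral_const_mul]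
  exact mul_le_mul_of_nonneg_left (hi j).2
    (mul_nonneg two_pos.le (Real.rpow_nonneg (hT j).le _))

/-- The target moment is well defined, and bounded in terms of `k` and `M` only. -/
theorem integrable_prod_coord [IsProbabilityMeasure ν] (hk : ∀ j, 1 < k j)
    (hk1 : ∑ j, 1 / k j < 1)
    (hν : ∀ j, eLpNorm (fun x : Fin d → ℝ => x j) (ENNReal.ofReal (k j)) ν ≤ M) :
    Integrable (fun x : Fin d → ℝ => ∏ j, x j) ν ∧
      |∫ x, ∏ j, x j ∂ν| ≤ 1 + ∑ j, momentConst k M j := by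
  have hi := integrable_momentMajorant hk hk1 hν
  have hs : Integrable (fun x => ∑ j, momentMajorant k j x) ν :=
    integrable_finsetSum _ fun j _ => (hi j).1
  have hd : Integrable (fun x => 1 + ∑ j, momentMajorant k j x) ν := (integrable_const 1).add hs
  have hle : ∀ x : Fin d → ℝ, ‖∏ j, x j‖ ≤ 1 + ∑ j, momentMajorant k j x := fun x => by
    rw [Real.norm_eq_abs, Finset.abs_prod]
    exact prod_abs_le hk hk1 x
  refine ⟨hd.mono' (Measurable.aestronglyMeasurable (by fun_prop)) (ae_of_all _ hle), ?_⟩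
  rw [← Real.norm_eq_abs]
  refine (norm_integral_le_of_norm_le hd (ae_of_all _ hle)).trans ?_
  rw [integral_add (integrable_const 1) hs, integral_finsetSum _ fun j _ => (hi j).1]
  simp only [integral_const, probReal_univ, one_smul]
  gcongr with j
  exact (hi j).2

theorem integrable_prod_trunc [IsProbabilityMeasure ν] {T : Fin d → ℝ} (hT : ∀ j, 0 ≤ T j) :
    Integrable (fun x : Fin d → ℝ => ∏ j, trunc (x j) (T j)) ν :=
  .of_bound (measurable_prod_trunc T).aestronglyMeasurable (∏ j, T j) (ae_of_all _ fun x => by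
    rw [Real.norm_eq_abs, Finset.abs_prod]
    exact Finset.prod_le_prod (fun j _ => abs_nonneg _) fun j _ => abs_trunc_le (hT j))

theorem abs_truncMoment_sub_le [IsProbabilityMeasure ν] (hk : ∀ j, 1 < k j)
    (hk1 : ∑ j, 1 / k j < 1)
    (hν : ∀ j, eLpNorm (fun x : Fin d → ℝ => x j) (ENNReal.ofReal (k j)) ν ≤ M) {T : Fin d → ℝ}
    (hT : ∀ j, 0 < T j) : |truncMoment ν T - ∫ x, ∏ j, x j ∂ν| ≤ biasBound k M T :=
  abs_integral_sub_integral_le hk hk1 hν (integrable_prod_trunc fun j => (hT j).le)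
    (integrable_prod_coord hk hk1 hν).1 hT fun x => abs_prod_sub_prod_le hk hk1 hT
      (fun j => abs_trunc_le_abs (x j) (hT j).le) (fun _ => le_rfl) fun _ h => trunc_of_abs_le h

theorem abs_truncMoment_min_sub_le [IsProbabilityMeasure ν] (hk : ∀ j, 1 < k j)
    (hk1 : ∑ j, 1 / k j < 1)
    (hν : ∀ j, eLpNorm (fun x : Fin d → ℝ => x j) (ENNReal.ofReal (k j)) ν ≤ M)
    {T T' : Fin d → ℝ} (hT : ∀ j, 0 < T j) (hT' : ∀ j, 0 < T' j) :
    |truncMoment ν (fun j => min (T j) (T' j)) - truncMoment ν T'| ≤ biasBound k M T :=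
  abs_integral_sub_integral_le hk hk1 hν
    (integrable_prod_trunc fun j => (lt_min (hT j) (hT' j)).le)
    (integrable_prod_trunc fun j => (hT' j).le) hT fun x => abs_prod_sub_prod_le hk hk1 hT
      (fun j => abs_trunc_le_abs (x j) (lt_min (hT j) (hT' j)).le)
      (fun j => abs_trunc_le_abs (x j) (hT' j).le) fun j h => trunc_min_of_abs_le (T' j) h

end Bias

/-! ### The oracle inequality -/

section Oracle

variable {d n : ℕ}

theorem penalty_mono (hn : 2 ≤ n) {κ : ℝ} (hκ : 0 ≤ κ) (β : Fin d → ℝ) {T T' : Fin d → grid n}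
    (h : ∀ j, T j ≤ T' j) : penalty κ β T ≤ penalty κ β T' := by
  unfold penalty
  refine mul_le_mul_of_nonneg_left (div_le_div_of_nonneg_right ?_
    (mul_nonneg n.cast_nonneg (Finset.prod_nonneg fun _ _ => sq_nonneg _))) hκ
  refine Finset.prod_le_prod (fun _ _ => sq_nonneg _) fun j _ => ?_
  exact pow_le_pow_left₀ (zero_le_one.trans (one_le_of_mem_grid hn (T j).2)) (h j) 2

theorem sq_add_three_le (x y z : ℝ) : (x + y + z) ^ 2 ≤ 3 * (x ^ 2 + y ^ 2 + z ^ 2) := by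
  nlinarith [sq_nonneg (x - y), sq_nonneg (y - z), sq_nonneg (x - z)]

theorem sq_sub_le_biasProxy_add_penalty (κ : ℝ) (β : Fin d → ℝ)
    (z : Fin n → Fin d → grid n → ℝ) (T T' : Fin d → grid n) :
    (momentEstPair z T T' - momentEst z T') ^ 2 ≤ biasProxy κ β z T + penalty κ β T' := by
  have h := le_ciSup (f := fun T' : Fin d → grid n =>
    max (|momentEstPair z T T' - momentEst z T'| ^ 2 - penalty κ β T') 0)
    (Set.finite_range _).bddAbove T'
  have h' := (le_max_left _ _).trans h
  rw [sq_abs] at h'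
  unfold biasProxy
  linarith

theorem momentEstPair_comm (z : Fin n → Fin d → grid n → ℝ) (T T' : Fin d → grid n) :
    momentEstPair z T T' = momentEstPair z T' T := by
  unfold momentEstPair
  simp only [min_comm]

/-- On the event that all deviations are controlled by the penalty, the bias proxy is controlled
by the true bias: the two deviations involved are absorbed by the penalty it subtracts. -/
theorem biasProxy_le (hn : 2 ≤ n) {κ : ℝ} (hκ : 0 ≤ κ) {β : Fin d → ℝ}
    {z : Fin n → Fin d → grid n → ℝ} {g : (Fin d → grid n) → ℝ}
    (hdev : ∀ T, (momentEst z T - g T) ^ 2 ≤ penalty κ β T / 6) {T : Fin d → grid n} {B : ℝ}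
    (hB : ∀ T', |g (fun j => min (T j) (T' j)) - g T'| ≤ B) : biasProxy κ β z T ≤ 3 * B ^ 2 := by
  have : Nonempty (Fin d → grid n) := ⟨T⟩
  refine ciSup_le fun T' => max_le ?_ (by positivity)
  rw [sq_abs]
  have h1 := hdev fun j => min (T j) (T' j)
  have h2 := hdev T'
  have h3 : penalty κ β (fun j => min (T j) (T' j)) ≤ penalty κ β T' :=
    penalty_mono hn hκ β fun j => min_le_right _ _
  have h4 := pow_le_pow_left₀ (abs_nonneg _) (hB T') 2
  rw [sq_abs] at h4
  have h5 := sq_add_three_le (momentEstPair z T T' - g fun j => min (T j) (T' j))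
    (g (fun j => min (T j) (T' j)) - g T') (g T' - momentEst z T')
  have h6 : momentEstPair z T T' = momentEst z fun j => min (T j) (T' j) := rfl
  have h7 : (g T' - momentEst z T') ^ 2 = (momentEst z T' - g T') ^ 2 := by ring
  rw [h7, h6] at h5
  rw [h6]
  have h8 : momentEst z (fun j => min (T j) (T' j)) - (g fun j => min (T j) (T' j)) +
      (g (fun j => min (T j) (T' j)) - g T') + (g T' - momentEst z T') =
      momentEst z (fun j => min (T j) (T' j)) - momentEst z T' := by ring
  rw [h8] at h5
  linarith

/-- The selected levels do as well as any fixed levels `T`, up to constants. The comparison runs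
through the estimator with levels `min T (S z)`, which is symmetric in `T` and `S z`. -/
theorem IsSelector.sq_error_le (hn : 2 ≤ n) {κ : ℝ} (hκ : 0 ≤ κ) {β : Fin d → ℝ}
    {S : (Fin n → Fin d → grid n → ℝ) → Fin d → grid n} (hS : IsSelector κ β S)
    {z : Fin n → Fin d → grid n → ℝ} {g : (Fin d → grid n) → ℝ} {g₀ : ℝ}
    (hdev : ∀ T, (momentEst z T - g T) ^ 2 ≤ penalty κ β T / 6) {T : Fin d → grid n} {B : ℝ}
    (hB : ∀ T', |g (fun j => min (T j) (T' j)) - g T'| ≤ B) (hB₀ : |g T - g₀| ≤ B) :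
    (momentEst z (S z) - g₀) ^ 2 ≤ 24 * B ^ 2 + 7 * penalty κ β T := by
  have h1 := biasProxy_le hn hκ hdev hB
  have h2 := sq_sub_le_biasProxy_add_penalty κ β z T (S z)
  have h3 := sq_sub_le_biasProxy_add_penalty κ β z (S z) T
  rw [momentEstPair_comm z (S z) T] at h3
  have h4 := hS.2 z T
  have h5 := pow_le_pow_left₀ (abs_nonneg _) hB₀ 2
  rw [sq_abs] at h5
  have h6 := hdev T
  have h7 := sq_add_three_le (-(momentEstPair z T (S z) - momentEst z (S z)))
    (momentEstPair z T (S z) - momentEst z T) (momentEst z T - g₀)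
  have h8 : -(momentEstPair z T (S z) - momentEst z (S z)) +
      (momentEstPair z T (S z) - momentEst z T) + (momentEst z T - g₀) =
      momentEst z (S z) - g₀ := by ring
  rw [h8, neg_sq] at h7
  nlinarith [sq_nonneg (momentEst z T - g T - (g T - g₀))]

end Oracle

/-! ### The choice of the oracle levels -/

/-- The dyadic levels approximate every real number of the right range up to constants. -/
theorem exists_mem_grid {n : ℕ} (hn : 2 ≤ n) {t R : ℝ} (ht : 1 ≤ t) (hR : 1 ≤ R)
    (htR : t ≤ R * n) : ∃ T ∈ grid n, t / (2 * R) ≤ T ∧ T ≤ 2 * t := by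
  have hn0 : (0 : ℝ) < n := by positivity
  have ht0 : 0 < t := by linarith
  have hlog : 1 ≤ Nat.log 2 n := Nat.log_pos one_lt_two hn
  have htt : t / (2 * R) ≤ t := div_le_self ht0.le (by linarith)
  rcases le_total (n / 2 : ℝ) t with h | h
  · refine ⟨n / 2, mem_grid.2 ⟨1, ⟨le_rfl, hlog⟩, by simp⟩, ?_, by linarith⟩
    rw [div_le_iff₀ (by positivity)]
    linarith
  · have hy : 1 ≤ n / t := by rw [one_le_div ht0]; linarith
    obtain ⟨r, hr1, hr2⟩ := exists_nat_pow_near hy one_lt_two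
    have hp : (0 : ℝ) < 2 ^ r := by positivity
    rw [le_div_iff₀ ht0] at hr1
    rw [div_lt_iff₀ ht0] at hr2
    refine ⟨n / 2 ^ r, mem_grid.2 ⟨r, ⟨?_, ?_⟩, rfl⟩, htt.trans ?_, ?_⟩
    · by_contra h0
      have : r = 0 := by omega
      subst this
      norm_num at hr2
      linarith
    · refine Nat.le_log_of_pow_le one_lt_two ?_
      have : (2 : ℝ) ^ r ≤ n := by nlinarith
      exact_mod_cast this
    · rw [le_div_iff₀ hp]
      linarith
    · rw [div_le_iff₀ hp]
      rw [pow_succ] at hr2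
      linarith

theorem log_le_log_div_log_two {n : ℕ} (hn : 2 ≤ n) :
    (Nat.log 2 n : ℝ) ≤ Real.log n / Real.log 2 := by
  rw [le_div_iff₀ (Real.log_pos one_lt_two), ← Real.log_pow]
  refine Real.log_le_log (by positivity) ?_
  exact_mod_cast Nat.pow_log_le_self 2 (by omega)

/-- With truncation levels of order `N ^ (1 / (2 k j))`, where `N` is the effective sample size,
squared bias and penalty are both of the order of the rate. -/
theorem exists_oracle {d : ℕ} {k : Fin d → ℝ} (hk : ∀ j, 1 < k j) (hk1 : ∑ j, 1 / k j < 1)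
    (M : ℝ≥0) {c₀ : ℝ} (hc₀ : 0 ≤ c₀) : ∃ C : ℝ, 0 ≤ C ∧ ∀ n : ℕ, 2 ≤ n → ∀ α : Fin d → ℝ,
      (∀ j, 0 < α j ∧ α j ≤ 1) → 1 ≤ (n * ∏ j, α j ^ 2) / Real.log n ^ (2 * d + 1) →
      ∃ T : Fin d → grid n,
        24 * biasBound k M (fun j => (T j : ℝ)) ^ 2 +
            7 * penalty (c₀ * Real.log n) (fun j => noiseLevel n (α j)) T ≤
          C * ((n * ∏ j, α j ^ 2) / Real.log n ^ (2 * d + 1)) ^ (-(1 - ∑ j, 1 / k j)) := by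
  have hlog2 : 0 < Real.log 2 := Real.log_pos one_lt_two
  have hlog21 : Real.log 2 ≤ 1 := by
    have := Real.log_two_lt_d9
    linarith
  set s := ∑ j, 1 / k j with hs
  set R : ℝ := (Real.log 2 ^ (2 * d + 1))⁻¹ with hR
  have hR1 : 1 ≤ R := (one_le_inv₀ (by positivity)).2 (pow_le_one₀ hlog2.le hlog21)
  have hR0 : 0 < R := by linarith
  set Cb : ℝ := ∑ j, 2 * (2 * R) ^ (k j * (1 - s)) * momentConst k M j with hCb
  set Cv : ℝ := c₀ * 4 ^ d * (Real.log 2 ^ (2 * d))⁻¹ with hCv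
  refine ⟨24 * Cb ^ 2 + 7 * Cv, by positivity, ?_⟩
  intro n hn α hα hN
  set N : ℝ := (n * ∏ j, α j ^ 2) / Real.log n ^ (2 * d + 1) with hNdef
  have hN0 : 0 < N := by linarith
  have hn0 : (0 : ℝ) < n := by positivity
  have hlogn : Real.log 2 ≤ Real.log n :=
    Real.log_le_log two_pos (by exact_mod_cast hn)
  have hlogn0 : 0 < Real.log n := by linarith
  have hp0 : 0 < ∏ j, α j ^ 2 := Finset.prod_pos fun j _ => pow_pos (hα j).1 2
  have hp1 : ∏ j, α j ^ 2 ≤ 1 := Finset.prod_le_one (fun j _ => sq_nonneg _) fun j _ =>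
    pow_le_one₀ (hα j).1.le (hα j).2
  have hNR : N ≤ R * n := by
    rw [hNdef, hR, inv_mul_eq_div]
    have : (n : ℝ) * ∏ j, α j ^ 2 ≤ n := mul_le_of_le_one_right hn0.le hp1
    gcongr
  have hk0 : ∀ j, 0 < k j := fun j => by linarith [hk j]
  have hex : ∀ j, ∃ T : grid n, N ^ (1 / (2 * k j)) / (2 * R) ≤ T ∧
      (T : ℝ) ≤ 2 * N ^ (1 / (2 * k j)) := by
    intro j
    have h1 : 1 ≤ N ^ (1 / (2 * k j)) :=
      Real.one_le_rpow hN (by have := hk0 j; positivity)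
    have h2 : N ^ (1 / (2 * k j)) ≤ N := by
      conv_rhs => rw [← Real.rpow_one N]
      refine Real.rpow_le_rpow_of_exponent_le hN ?_
      rw [div_le_one (by linarith [hk0 j])]
      linarith [hk j]
    obtain ⟨T, hT, h3, h4⟩ := exists_mem_grid hn h1 hR1 (h2.trans hNR)
    exact ⟨⟨T, hT⟩, h3, h4⟩
  choose T hT1 hT2 using hex
  refine ⟨T, ?_⟩
  have hbias : biasBound k M (fun j => (T j : ℝ)) ≤ Cb * N ^ (-((1 - s) / 2)) := by
    unfold biasBound
    rw [hCb, Finset.sum_mul]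
    refine Finset.sum_le_sum fun j _ => ?_
    have hρ : 0 ≤ k j * (1 - s) := mul_nonneg (hk0 j).le (by linarith)
    have hNk : 0 < N ^ (1 / (2 * k j)) := Real.rpow_pos_of_pos hN0 _
    have h1 : (T j : ℝ) ^ (-(k j * (1 - s))) ≤
        (2 * R) ^ (k j * (1 - s)) * N ^ (-((1 - s) / 2)) := by
      calc (T j : ℝ) ^ (-(k j * (1 - s)))
          ≤ (N ^ (1 / (2 * k j)) / (2 * R)) ^ (-(k j * (1 - s))) :=
            Real.rpow_le_rpow_of_nonpos (by positivity) (hT1 j) (by linarith)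
        _ = (2 * R) ^ (k j * (1 - s)) * N ^ (-((1 - s) / 2)) := by
            rw [Real.div_rpow hNk.le (by positivity), ← Real.rpow_mul hN0.le,
              Real.rpow_neg (by positivity : (0 : ℝ) ≤ 2 * R), div_inv_eq_mul, mul_comm]
            congr 2
            have := (hk0 j).ne'
            field_simp
    calc 2 * (T j : ℝ) ^ (-(k j * (1 - s))) * momentConst k M j
        ≤ 2 * ((2 * R) ^ (k j * (1 - s)) * N ^ (-((1 - s) / 2))) * momentConst k M j := by
          have := momentConst_nonneg k M j
          gcongr
      _ = _ := by ring
  have hbias0 : 0 ≤ biasBound k M (fun j => (T j : ℝ)) :=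
    Finset.sum_nonneg fun j _ => mul_nonneg (mul_nonneg two_pos.le (Real.rpow_nonneg
      (zero_le_one.trans (one_le_of_mem_grid hn (T j).2)) _)) (momentConst_nonneg k M j)
  have hbias2 : biasBound k M (fun j => (T j : ℝ)) ^ 2 ≤ Cb ^ 2 * N ^ (-(1 - s)) := by
    refine (pow_le_pow_left₀ hbias0 hbias 2).trans_eq ?_
    rw [mul_pow, ← Real.rpow_natCast (N ^ _), ← Real.rpow_mul hN0.le]
    congr 2
    push_cast
    ring
  have hprodT : ∏ j, (T j : ℝ) ^ 2 ≤ 4 ^ d * N ^ s := by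
    calc ∏ j, (T j : ℝ) ^ 2 ≤ ∏ j, 4 * N ^ (1 / k j) :=
          Finset.prod_le_prod (fun j _ => sq_nonneg _) fun j _ => by
            refine (pow_le_pow_left₀ (zero_le_one.trans (one_le_of_mem_grid hn (T j).2))
              (hT2 j) 2).trans_eq ?_
            rw [mul_pow, ← Real.rpow_natCast (N ^ _), ← Real.rpow_mul hN0.le]
            have := (hk0 j).ne'
            congr 2
            · norm_num
            · push_cast
              field_simp
      _ = 4 ^ d * N ^ s := by
          rw [Finset.prod_mul_distrib, Finset.prod_const, Finset.card_univ, Fintype.card_fin,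
            hs, Real.rpow_sum_of_pos hN0]
  have hL := one_le_log_two hn
  have hpen : penalty (c₀ * Real.log n) (fun j => noiseLevel n (α j)) T ≤
      Cv * N ^ (-(1 - s)) := by
    have e1 : ∏ j, noiseLevel n (α j) ^ 2 = (∏ j, α j ^ 2) / (Nat.log 2 n : ℝ) ^ (2 * d) := by
      unfold noiseLevel
      simp only [div_pow, Finset.prod_div_distrib, Finset.prod_const, Finset.card_univ,
        Fintype.card_fin, ← pow_mul]
    have e2 : penalty (c₀ * Real.log n) (fun j => noiseLevel n (α j)) T =
        c₀ * (Real.log n * (Nat.log 2 n : ℝ) ^ (2 * d) * (∏ j, (T j : ℝ) ^ 2) /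
          (n * ∏ j, α j ^ 2)) := by
      unfold penalty
      rw [e1]
      field_simp
    have e3 : (Nat.log 2 n : ℝ) ^ (2 * d) ≤ (Real.log n / Real.log 2) ^ (2 * d) :=
      pow_le_pow_left₀ (by linarith) (log_le_log_div_log_two hn) _
    have e4 : N ^ (-(1 - s)) = N ^ s / N := by
      rw [neg_sub, Real.rpow_sub_one hN0.ne']
    rw [e2, e4]
    have hT20 : 0 ≤ ∏ j, (T j : ℝ) ^ 2 := Finset.prod_nonneg fun _ _ => sq_nonneg _
    calc c₀ * (Real.log n * (Nat.log 2 n : ℝ) ^ (2 * d) * (∏ j, (T j : ℝ) ^ 2) /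
          (n * ∏ j, α j ^ 2))
        ≤ c₀ * (Real.log n * (Real.log n / Real.log 2) ^ (2 * d) * (4 ^ d * N ^ s) /
          (n * ∏ j, α j ^ 2)) := by gcongr
      _ = Cv * (N ^ s / N) := by
          have hNs : N ^ s ≠ 0 := (Real.rpow_pos_of_pos hN0 s).ne'
          generalize N ^ s = y at *
          rw [hCv, hNdef, div_pow]
          field_simp
          ring
  calc _ ≤ 24 * (Cb ^ 2 * N ^ (-(1 - s))) + 7 * (Cv * N ^ (-(1 - s))) := by gcongr
    _ = _ := by ring

/-! ### The risk bound -/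

theorem rate_exponent {d : ℕ} (hd : 0 < d) {k : Fin d → ℝ} (hk : ∀ j, 1 < k j) :
    (harmonicMean k - d) / harmonicMean k = 1 - ∑ j, 1 / k j := by
  have hs : 0 < ∑ j, 1 / k j := by
    have : Nonempty (Fin d) := ⟨⟨0, hd⟩⟩
    exact Finset.sum_pos (fun j _ => one_div_pos.2 (by linarith [hk j])) Finset.univ_nonempty
  have hd0 : (0 : ℝ) < d := by exact_mod_cast hd
  unfold harmonicMean
  generalize ∑ j, 1 / k j = s at *
  field_simp

theorem scaleProd_pow_four_le {d n : ℕ} (hn : 2 ≤ n) {α : Fin d → ℝ} (hα : ∀ j, 0 < α j)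
    (T : Fin d → grid n) :
    (scaleProd (fun j => noiseLevel n (α j)) fun j => (T j : ℝ)) ^ 4 ≤
      16 ^ d * (n : ℝ) ^ (8 * d) / (∏ j, α j) ^ 4 := by
  have hL := one_le_log_two hn
  have hLn : (Nat.log 2 n : ℝ) ≤ n := by exact_mod_cast Nat.log_le_self 2 n
  have h : scaleProd (fun j => noiseLevel n (α j)) (fun j => (T j : ℝ)) ≤
      (2 * (n : ℝ) ^ 2) ^ d / ∏ j, α j := by
    calc scaleProd (fun j => noiseLevel n (α j)) (fun j => (T j : ℝ))
        ≤ ∏ j, 2 * (n : ℝ) ^ 2 / α j := by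
          refine Finset.prod_le_prod (fun j _ => (noiseScale_pos hn
            (div_pos (hα j) (by linarith)) (T j).2).le) fun j _ => ?_
          have := hα j
          have h1 := le_of_mem_grid (T j).2
          have h0 := one_le_of_mem_grid hn (T j).2
          have e : noiseScale (noiseLevel n (α j)) (T j) = 2 * (T j * Nat.log 2 n) / α j := by
            unfold noiseScale noiseLevel
            field_simp
          rw [e]
          gcongr
          nlinarith
      _ = _ := by
          rw [Finset.prod_div_distrib, Finset.prod_const, Finset.card_univ, Fintype.card_fin]
  refine (pow_le_pow_left₀ (Finset.prod_nonneg fun j _ => (noiseScale_pos hn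
    (div_pos (hα j) (by linarith)) (T j).2).le) h 4).trans_eq ?_
  rw [div_pow, ← pow_mul, mul_pow, ← pow_mul, mul_comm d 4, pow_mul 2 4 d]
  norm_num
  ring_nf

/-- Splitting of the risk over a good event, on which a deterministic bound holds, and its
complement, which is handled by a fourth moment. -/
theorem integral_sq_le_of_good_event {Ω : Type*} [MeasurableSpace Ω] {P : Measure Ω}
    [IsProbabilityMeasure P] {e H : Ω → ℝ} (he : AEMeasurable e P) (hH : Integrable H P)
    (heH : ∀ ω, e ω ^ 4 ≤ H ω) {D η p : ℝ} (hD : 0 ≤ D) (hη : 0 < η) {bad : Set Ω}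
    (hbad : ∀ ω, ω ∉ bad → e ω ^ 2 ≤ D) (hp : P.real bad ≤ p) :
    Integrable (fun ω => e ω ^ 2) P ∧ ∫ ω, e ω ^ 2 ∂P ≤ D + η * ∫ ω, H ω ∂P + p / η := by
  -- the bad event need not be measurable; its measurable hull has the same probability
  have hms := measurableSet_toMeasurable P bad
  have hi : Integrable ((toMeasurable P bad).indicator fun _ => 1 / η) P :=
    (integrable_const _).indicator hms
  have hd : Integrable (fun ω => D + η * H ω) P := (integrable_const D).add (hH.const_mul η)
  have hpt : ∀ ω, e ω ^ 2 ≤ D + η * H ω + (toMeasurable P bad).indicator (fun _ => 1 / η) ω := by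
    intro ω
    have h0 : 0 ≤ H ω := (Even.pow_nonneg ⟨2, rfl⟩ _).trans (heH ω)
    by_cases hω : ω ∈ toMeasurable P bad
    · rw [Set.indicator_of_mem hω]
      have h1 : e ω ^ 2 ≤ η * e ω ^ 4 + 1 / η := by
        have h2 : η * e ω ^ 4 + 1 / η - e ω ^ 2 =
            ((η * e ω ^ 2 - 1 / 2) ^ 2 + 3 / 4) / η := by
          field_simp
          ring
        have h3 : 0 ≤ ((η * e ω ^ 2 - 1 / 2) ^ 2 + 3 / 4) / η := by positivity
        linarith
      have h2 := mul_le_mul_of_nonneg_left (heH ω) hη.le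
      linarith
    · rw [Set.indicator_of_notMem hω]
      have h1 := hbad ω fun h => hω (subset_toMeasurable P bad h)
      have h2 := mul_nonneg hη.le h0
      linarith
  have hint : Integrable (fun ω => e ω ^ 2) P :=
    (hd.add hi).mono' (he.pow_const 2).aestronglyMeasurable (ae_of_all _ fun ω => by
      rw [Real.norm_eq_abs, abs_of_nonneg (sq_nonneg _)]
      exact hpt ω)
  refine ⟨hint, (integral_mono hint (hd.add hi) hpt).trans ?_⟩
  rw [integral_add' hd hi, integral_add (integrable_const D) (hH.const_mul η), integral_const_mul,
    integral_indicator_const _ hms, measureReal_def, measure_toMeasurable, ← measureReal_def]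
  simp only [integral_const, probReal_univ, smul_eq_mul]
  have : P.real bad * (1 / η) ≤ p / η := by
    rw [mul_one_div]
    gcongr
  linarith

/-- The risk bound, from norm bounds alone: the coordinates are measurable, so a finite norm is
already membership in the corresponding space. -/
theorem exists_risk_le (d : ℕ) (hd : 0 < d) {cbar : ℝ} (hcbar : 0 < cbar) :
    ∃ C₀ : ℝ, 0 < C₀ ∧ ∀ c₀ : ℝ, C₀ ≤ c₀ →
      ∀ k : Fin d → ℝ, (∀ j, 1 < k j) → ∑ j, 1 / k j < 1 →
      ∀ M : ℝ≥0, ∃ c : ℝ, 0 < c ∧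
      ∀ ν : Measure (Fin d → ℝ), IsProbabilityMeasure ν →
      (∀ j, eLpNorm (fun x : Fin d → ℝ => x j) (ENNReal.ofReal (k j)) ν ≤ M) →
      ∀ n : ℕ, 2 ≤ n → ∀ α : Fin d → ℝ, (∀ j, 0 < α j ∧ α j ≤ 1) →
      1 ≤ (n * ∏ j, α j ^ 2) / Real.log n ^ (2 * d + 1) →
      ∀ (Ω : Type*) [MeasurableSpace Ω] (P : Measure Ω) [IsProbabilityMeasure P]
        (X : Fin n → Ω → Fin d → ℝ) (ξ : Fin n → Fin d → grid n → Ω → ℝ),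
      IsSample P ν (fun j => noiseLevel n (α j)) X ξ →
      ∀ S : (Fin n → Fin d → grid n → ℝ) → Fin d → grid n,
      IsSelector (c₀ * Real.log n) (fun j => noiseLevel n (α j)) S →
      Integrable (fun ω => (momentEst (publicData X ξ ω) (S (publicData X ξ ω)) -
        ∫ x, ∏ j, x j ∂ν) ^ 2) P ∧
      ∫ ω, (momentEst (publicData X ξ ω) (S (publicData X ξ ω)) - ∫ x, ∏ j, x j ∂ν) ^ 2 ∂P ≤
        c * ((n * ∏ j, α j ^ 2) / Real.log n ^ (2 * d + 1)) ^
            (-((harmonicMean k - d) / harmonicMean k)) +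
          c / ((∏ j, α j ^ 2) * (n : ℝ) ^ cbar) := by
  -- `η = n ^ (-m) * ∏ α ^ 2` makes the fourth-moment term small, and the exponent `b` of the
  -- probability of the bad event then has to outweigh `1 / η`
  set m : ℝ := 9 * d + cbar with hm
  set b : ℝ := d + m + cbar with hb
  obtain ⟨C₀, hC₀, hdev⟩ := exists_measureReal_deviation_le d (b := b) (by positivity)
  refine ⟨C₀, hC₀, fun c₀ hc₀ k hk hk1 M => ?_⟩
  have hc₀0 : 0 < c₀ := hC₀.trans_le hc₀
  obtain ⟨C, hC, horacle⟩ := exists_oracle hk hk1 M hc₀0.le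
  set G : ℝ := (1 + ∑ j, momentConst k M j) ^ 4 with hG
  have hG0 : 0 ≤ G := Even.pow_nonneg ⟨2, rfl⟩ _
  set c : ℝ := C + (8 * (G + 98560 ^ d) + (2 * d + 2)) with hc
  refine ⟨c, by positivity, ?_⟩
  intro ν hνp hν n hn α hα hN Ω _ P _ X ξ h S hS
  rw [rate_exponent hd hk]
  have hn0 : (0 : ℝ) < n := by positivity
  have hn1 : (1 : ℝ) ≤ n := by exact_mod_cast (by omega : 1 ≤ n)
  have hL := one_le_log_two hn
  have hβ : ∀ j, 0 < noiseLevel n (α j) := fun j => div_pos (hα j).1 (by linarith)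
  have hβ1 : ∀ j, noiseLevel n (α j) ≤ 1 := fun j => by
    unfold noiseLevel
    rw [div_le_one (by linarith)]
    linarith [(hα j).2]
  have hκ : 0 ≤ c₀ * Real.log n := mul_nonneg hc₀0.le (Real.log_natCast_nonneg n)
  obtain ⟨T, hT⟩ := horacle n hn α hα hN
  set γ := ∫ x, ∏ j, x j ∂ν with hγ
  set N : ℝ := (n * ∏ j, α j ^ 2) / Real.log n ^ (2 * d + 1) with hNdef
  set A : ℝ := ∏ j, α j with hA
  have hA0 : 0 < A := Finset.prod_pos fun j _ => (hα j).1
  have hA1 : A ≤ 1 := Finset.prod_le_one (fun j _ => (hα j).1.le) fun j _ => (hα j).2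
  have hA2 : ∏ j, α j ^ 2 = A ^ 2 := Finset.prod_pow _ _ _
  have hTpos : ∀ (T : Fin d → grid n) j, (0 : ℝ) < T j := fun T j =>
    zero_lt_one.trans_le (one_le_of_mem_grid hn (T j).2)
  set e : Ω → ℝ := fun ω => momentEst (publicData X ξ ω) (S (publicData X ξ ω)) - γ with he
  set H : Ω → ℝ := fun ω => 8 * (∑ T : Fin d → grid n, momentEst (publicData X ξ ω) T ^ 4 + G)
    with hH
  set η : ℝ := (n : ℝ) ^ (-m) * A ^ 2 with hη
  have hη0 : 0 < η := by positivity
  have h4 := fun T : Fin d → grid n => h.integrable_momentEst_pow_four hn hβ hβ1 T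
  have hsum : Integrable (fun ω => ∑ T : Fin d → grid n, momentEst (publicData X ξ ω) T ^ 4) P :=
    integrable_finsetSum _ fun T _ => (h4 T).1
  have hHi : Integrable H P := (hsum.add (integrable_const G)).const_mul 8
  have hγG : γ ^ 4 ≤ G := by
    rw [← Even.pow_abs ⟨2, rfl⟩ γ]
    exact pow_le_pow_left₀ (abs_nonneg _) (integrable_prod_coord hk hk1 hν).2 4
  have heH : ∀ ω, e ω ^ 4 ≤ H ω := by
    intro ω
    have h1 : e ω ^ 4 ≤ 2 ^ (4 - 1) *
        (momentEst (publicData X ξ ω) (S (publicData X ξ ω)) ^ 4 + (-γ) ^ 4) := by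
      rw [he]
      simp only [sub_eq_add_neg]
      exact Even.add_pow_le ⟨2, rfl⟩
    have h2 := Finset.single_le_sum (s := Finset.univ)
      (f := fun T : Fin d → grid n => momentEst (publicData X ξ ω) T ^ 4)
      (fun T _ => Even.pow_nonneg ⟨2, rfl⟩ _) (Finset.mem_univ (S (publicData X ξ ω)))
    rw [Even.neg_pow ⟨2, rfl⟩] at h1
    norm_num at h1
    simp only [hH]
    linarith
  have hHle : η * ∫ ω, H ω ∂P ≤ 8 * (G + 98560 ^ d) * ((n : ℝ) ^ (-cbar) / A ^ 2) := by
    have h1 : ∫ ω, H ω ∂P ≤ 8 * ((n : ℝ) ^ (9 * d) * (98560 ^ d / A ^ 4) + G) := by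
      rw [hH, integral_const_mul, integral_add hsum (integrable_const G),
        integral_finsetSum _ fun T _ => (h4 T).1]
      simp only [integral_const, probReal_univ, one_smul]
      gcongr
      calc ∑ T : Fin d → grid n, ∫ ω, momentEst (publicData X ξ ω) T ^ 4 ∂P
          ≤ ∑ _T : Fin d → grid n, 6160 ^ d * (16 ^ d * (n : ℝ) ^ (8 * d) / A ^ 4) :=
            Finset.sum_le_sum fun T _ => (h4 T).2.trans (mul_le_mul_of_nonneg_left
              (scaleProd_pow_four_le hn (fun j => (hα j).1) T) (by positivity))
        _ = ((grid n).card : ℝ) ^ d * (6160 ^ d * (16 ^ d * (n : ℝ) ^ (8 * d) / A ^ 4)) := by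
            simp
        _ ≤ (n : ℝ) ^ d * (6160 ^ d * (16 ^ d * (n : ℝ) ^ (8 * d) / A ^ 4)) := by
            gcongr
            exact_mod_cast card_grid_le_self n
        _ = (n : ℝ) ^ (9 * d) * (98560 ^ d / A ^ 4) := by
            rw [show (98560 : ℝ) = 6160 * 16 by norm_num, mul_pow]
            ring
    have h2 : G ≤ (n : ℝ) ^ (9 * d) * (G / A ^ 4) := by
      have h3 : G ≤ G / A ^ 4 := le_div_self hG0 (by positivity) (pow_le_one₀ hA0.le hA1)
      have h5 : (1 : ℝ) ≤ (n : ℝ) ^ (9 * d) := one_le_pow₀ hn1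
      exact h3.trans (le_mul_of_one_le_left (by positivity) h5)
    have h3 : (n : ℝ) ^ (-m) * (n : ℝ) ^ (9 * d) = (n : ℝ) ^ (-cbar) := by
      rw [← Real.rpow_natCast, ← Real.rpow_add hn0]
      congr 1
      rw [hm]
      push_cast
      ring
    calc η * ∫ ω, H ω ∂P
        ≤ η * (8 * ((n : ℝ) ^ (9 * d) * (98560 ^ d / A ^ 4) + (n : ℝ) ^ (9 * d) * (G / A ^ 4))) := by
          gcongr
          exact h1.trans (by gcongr)
      _ = 8 * (G + 98560 ^ d) * ((n : ℝ) ^ (-m) * (n : ℝ) ^ (9 * d) / A ^ 2) := by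
          rw [hη]
          field_simp
          ring
      _ = _ := by rw [h3]
  have hple : (2 * d + 2) * (n : ℝ) ^ ((d : ℝ) - b) / η =
      (2 * d + 2) * ((n : ℝ) ^ (-cbar) / A ^ 2) := by
    have h1 : (n : ℝ) ^ ((d : ℝ) - b) = (n : ℝ) ^ (-m) * (n : ℝ) ^ (-cbar) := by
      rw [← Real.rpow_add hn0]
      congr 1
      rw [hb]
      ring
    rw [hη, h1]
    have : (n : ℝ) ^ (-m) ≠ 0 := (Real.rpow_pos_of_pos hn0 _).ne'
    field_simp
  have hD : 0 ≤ C * N ^ (-(1 - ∑ j, 1 / k j)) :=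
    mul_nonneg hC (Real.rpow_nonneg (by linarith) _)
  obtain ⟨hint, hle⟩ := integral_sq_le_of_good_event (e := e) (H := H)
    (((measurable_momentEst_selector hS.1).comp_aemeasurable h.aemeasurable_publicData).sub_const γ)
    hHi heH hD hη0 (fun ω hω => by
      simp only [Set.mem_ofPred_eq, not_exists, not_lt] at hω
      exact (hS.sq_error_le hn hκ hω
        (fun T' => abs_truncMoment_min_sub_le hk hk1 hν (hTpos T) (hTpos T'))
        (abs_truncMoment_sub_le hk hk1 hν (hTpos T))).trans hT)
    (hdev c₀ hc₀ n hn ν _ hβ hβ1 P X ξ h)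
  refine ⟨hint, hle.trans ?_⟩
  have hx : c / ((∏ j, α j ^ 2) * (n : ℝ) ^ cbar) = c * ((n : ℝ) ^ (-cbar) / A ^ 2) := by
    rw [hA2, Real.rpow_neg hn0.le]
    field_simp
  rw [hx, hple]
  have hNr : 0 ≤ N ^ (-(1 - ∑ j, 1 / k j)) := Real.rpow_nonneg (by linarith) _
  have hy : 0 ≤ (n : ℝ) ^ (-cbar) / A ^ 2 := by positivity
  have h1 : C * N ^ (-(1 - ∑ j, 1 / k j)) ≤ c * N ^ (-(1 - ∑ j, 1 / k j)) :=
    mul_le_mul_of_nonneg_right (by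
      have : 0 ≤ 8 * (G + 98560 ^ d) + (2 * (d : ℝ) + 2) := by positivity
      linarith) hNr
  have h2 : (8 * (G + 98560 ^ d) + (2 * d + 2)) * ((n : ℝ) ^ (-cbar) / A ^ 2) ≤
      c * ((n : ℝ) ^ (-cbar) / A ^ 2) := mul_le_mul_of_nonneg_right (by linarith) hy
  linarith

end AdaptiveMoment

theorem mainTheorem7 (d : ℕ) (hd : 0 < d) :
    -- the privacy mechanism is `α`-CLDP
    (∀ n : ℕ, 2 ≤ n → ∀ α : Fin d → ℝ, (∀ j, 0 < α j) →
      AdaptiveMoment.IsCLDP α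
        (fun j => AdaptiveMoment.channel n (AdaptiveMoment.noiseLevel n (α j)))) ∧
    -- the risk bound; `C₀` depends on `d` and `cbar` only, and the constant `c` depends neither
    -- on `n` and `α`, nor on the law `ν` except through the bound `M` on the moments
    (∀ cbar : ℝ, 0 < cbar → ∃ C₀ : ℝ, 0 < C₀ ∧ ∀ c₀ : ℝ, C₀ ≤ c₀ →
      ∀ k : Fin d → ℝ, (∀ j, 1 < k j) → ∑ j, 1 / k j < 1 →
      ∀ M : ℝ≥0, ∃ c : ℝ, 0 < c ∧
      ∀ ν : Measure (Fin d → ℝ), IsProbabilityMeasure ν →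
      (∀ j, MemLp (fun x : Fin d → ℝ => x j) (ENNReal.ofReal (k j)) ν ∧
        eLpNorm (fun x : Fin d → ℝ => x j) (ENNReal.ofReal (k j)) ν ≤ M) →
      ∀ n : ℕ, 2 ≤ n → ∀ α : Fin d → ℝ, (∀ j, 0 < α j ∧ α j ≤ 1) →
      1 ≤ (n * ∏ j, α j ^ 2) / Real.log n ^ (2 * d + 1) →
      ∀ (Ω : Type*) [MeasurableSpace Ω] (P : Measure Ω) [IsProbabilityMeasure P]
        (X : Fin n → Ω → Fin d → ℝ) (ξ : Fin n → Fin d → AdaptiveMoment.grid n → Ω → ℝ),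
      AdaptiveMoment.IsSample P ν (fun j => AdaptiveMoment.noiseLevel n (α j)) X ξ →
      ∀ S : (Fin n → Fin d → AdaptiveMoment.grid n → ℝ) → Fin d → AdaptiveMoment.grid n,
      AdaptiveMoment.IsSelector (c₀ * Real.log n)
        (fun j => AdaptiveMoment.noiseLevel n (α j)) S →
      Integrable (fun ω =>
        (AdaptiveMoment.momentEst (AdaptiveMoment.publicData X ξ ω)
          (S (AdaptiveMoment.publicData X ξ ω)) - ∫ x, ∏ j, x j ∂ν) ^ 2) P ∧
      ∫ ω, (AdaptiveMoment.momentEst (AdaptiveMoment.publicData X ξ ω)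
          (S (AdaptiveMoment.publicData X ξ ω)) - ∫ x, ∏ j, x j ∂ν) ^ 2 ∂P ≤
        c * ((n * ∏ j, α j ^ 2) / Real.log n ^ (2 * d + 1)) ^
            (-((AdaptiveMoment.harmonicMean k - d) / AdaptiveMoment.harmonicMean k)) +
          c / ((∏ j, α j ^ 2) * (n : ℝ) ^ cbar)) := by
  refine ⟨fun n hn α hα => AdaptiveMoment.isCLDP_channel hn hα, fun cbar hcbar => ?_⟩
  obtain ⟨C₀, hC₀, h⟩ := AdaptiveMoment.exists_risk_le d hd hcbar
  refine ⟨C₀, hC₀, fun c₀ hc₀ k hk hk1 M => ?_⟩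
  obtain ⟨c, hc, h'⟩ := h c₀ hc₀ k hk hk1 M
  exact ⟨c, hc, fun ν hνp hν => h' ν hνp fun j => (hν j).2⟩
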